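/- For a rational number $x$ and an integer $n\ge 0$ let $(x)_n=x(x+1)\cdots(x+n-1)$, with $(x)_0=1$. Let $p$ be an odd prime and $s$ a positive integer such that $p^s\equiv 2\pmod 3$, and let $m=(2p^s-1)/3$ or $m=p^s-1$. Then $$\sum_{k=0}^{m}(6k+1)\frac{(1/3)_k^6}{k!^6}\equiv 10\,p^s\,\frac{(2/3)_{(2p^s-1)/3}^3}{(1)_{(2p^s-1)/3}^3}\pmod{p^{s+5}}.$$ Here the congruence means that both sides are rational numbers whose denominators are not divisible by $p$, and that the numerator of their difference, in lowest terms, is divisible by $p^{s+5}$. -/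

import Mathlib

/-- The shifted factorial `(x)_n = x (x + 1) ⋯ (x + n - 1)` of a rational number `x`. -/
noncomputable def shiftedFactorial (x : ℚ) (n : ℕ) : ℚ :=
  (ascPochhammer ℚ n).eval x

/-- Congruence of rational numbers modulo a positive integer `m`: both numbers have a denominator
(in lowest terms) prime to `m`, and `m` divides the numerator of their difference. For `m = p ^ r`
with `p` prime and `r ≥ 1` this says that `x` and `y` are `p`-integral and that
`x - y ∈ p ^ r ℤ_p`. -/
def RatModEq (m : ℕ) (x y : ℚ) : Prop :=
  x.den.Coprime m ∧ y.den.Coprime m ∧ (m : ℤ) ∣ (x - y).num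

/-! The hypotheses force p ≡ 2 (mod 3) and s odd, so p ≥ 5 and either s = 1 or s ≥ 3. The two cases
hold for different reasons.

For s ≥ 3 both sides vanish modulo p^(s+5). The terms of the given sum do not vanish separately (the
first is 1), but `sum_eq_sum_dualTerm` turns it into a sum of linear factors times cubes, and there
every term does. A Legendre-type count, `padicValRat_pochRatio`, gives the valuation of the base of
each cube as a sum over the powers p^i; where the base loses powers of p, the linear factor gains
some.

For s = 1 put N = (2p-1)/3 and w = 2p/3, so that -N = 1/3 - w. Five of the six parameters 1/3 are
replaced by 1/3 - w ζ^i, with ζ a primitive fifth root of unity. The ζ^i sum to zero, so the new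
series is 2-balanced; one parameter is -N, so it terminates; Dougall's formula `sum_dougallTerm`
evaluates it. The perturbation enters only through w^5, a multiple of p^5, and its first-order
coefficient is 0 modulo p: since 1/3 ≡ -N, the summands are antisymmetric under k ↦ N - k
(`sum_antisymm`). Hence the sum is unchanged modulo p^6, and the closed form agrees with the
right-hand side to that order. For m = p - 1 each additional term contains the sixth power of a
multiple of p. -/

open Finset

/-! ### Shifted factorial ratios -/

/-- `(x)_k / k!`, written as a product. -/
noncomputable def pochRatio {K : Type*} [Field K] (x : K) (k : ℕ) : K :=
  ∏ j ∈ range k, (x + j) / (1 + j)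

lemma pochRatio_succ {K : Type*} [Field K] (x : K) (k : ℕ) :
    pochRatio x (k + 1) = pochRatio x k * ((x + k) / (1 + k)) :=
  prod_range_succ _ _

lemma shiftedFactorial_eq_prod (x : ℚ) (n : ℕ) :
    shiftedFactorial x n = ∏ j ∈ range n, (x + j) := by
  induction n with
  | zero => simp [shiftedFactorial]
  | succ n ih =>
    rw [prod_range_succ, ← ih]
    simp [shiftedFactorial, ascPochhammer_succ_eval]

lemma factorial_eq_prod (n : ℕ) : (n.factorial : ℚ) = ∏ j ∈ range n, (1 + (j : ℚ)) := by
  induction n with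
  | zero => simp
  | succ n ih =>
    rw [prod_range_succ, ← ih, Nat.factorial_succ]
    push_cast
    ring

lemma pochRatio_eq_div_factorial (x : ℚ) (n : ℕ) :
    pochRatio x n = shiftedFactorial x n / n.factorial := by
  rw [pochRatio, prod_div_distrib, shiftedFactorial_eq_prod, factorial_eq_prod]

lemma pochRatio_eq_div (x : ℚ) (n : ℕ) :
    pochRatio x n = shiftedFactorial x n / shiftedFactorial 1 n := by
  rw [pochRatio, prod_div_distrib, shiftedFactorial_eq_prod, shiftedFactorial_eq_prod]

lemma pochRatio_ne_zero {x : ℚ} (hx : 0 < x) (n : ℕ) : pochRatio x n ≠ 0 :=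
  prod_ne_zero_iff.2 fun j _ => by positivity

/-! ### Transformation of the truncated sum -/

/-- The base of the cubes on the transformed side of `sum_eq_sum_dualTerm`. -/
noncomputable def dualBase (m k : ℕ) : ℚ :=
  (3 * m + 1) * pochRatio (1 / 3) m * pochRatio (1 / 3) k *
    (pochRatio (2 / 3) (m - k) / ((3 * (m - k : ℕ) + 1) * pochRatio (1 / 3) (m - k)))

lemma dualBase_self (m : ℕ) : dualBase m m = (3 * m + 1) * pochRatio (1 / 3) m ^ 2 := by
  simp [dualBase, pochRatio]
  ring

lemma dualBase_succ_left (m k : ℕ) (hk : k ≤ m) :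
    dualBase (m + 1) k = dualBase m k *
      ((3 * m + 4) * (3 * (m - k) + 2) / (3 * (m + 1) * (3 * (m - k) + 4))) := by
  obtain ⟨r, rfl⟩ := Nat.exists_eq_add_of_le' hk
  have h1 : r + k + 1 - k = r + 1 := by omega
  have h0 : pochRatio (1 / 3 : ℚ) r ≠ 0 := pochRatio_ne_zero (by norm_num) r
  simp only [dualBase, h1, Nat.add_sub_cancel, pochRatio_succ]
  push_cast
  have e : (r + k - k : ℚ) = r := by ring
  rw [e]
  have : (1 / 3 + r : ℚ) ≠ 0 := by positivity
  have h2 : (3 * (r + 1) + 1 : ℚ) ≠ 0 := by positivity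
  have h3 : (3 * r + 1 : ℚ) ≠ 0 := by positivity
  have h4 : (3 * r + 4 : ℚ) ≠ 0 := by positivity
  field_simp
  ring

lemma dualBase_succ_right (m k : ℕ) (hk : k + 1 ≤ m) :
    dualBase m (k + 1) * ((k + 1) * (3 * (m - k) - 1)) = dualBase m k *
      ((k + 1 / 3) * (3 * (m - k) + 1)) := by
  obtain ⟨r, rfl⟩ := Nat.exists_eq_add_of_le' hk
  have h1 : r + (k + 1) - k = r + 1 := by omega
  have h0 : pochRatio (1 / 3 : ℚ) r ≠ 0 := pochRatio_ne_zero (by norm_num) r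
  simp only [dualBase, h1, Nat.add_sub_cancel, pochRatio_succ]
  push_cast
  have e : (r + (k + 1) - k : ℚ) = r + 1 := by ring
  rw [e]
  have : (1 / 3 + r : ℚ) ≠ 0 := by positivity
  have h2 : (3 * (r + 1) + 1 : ℚ) ≠ 0 := by positivity
  have h3 : (3 * r + 1 : ℚ) ≠ 0 := by positivity
  field_simp
  ring

/-- Telescoping in k: the change of the dual term under m ↦ m + 1 is the difference in k of a
rational multiple of `dualBase m k ^ 3`. At j = m this supplies the inductive step of the
transformation. -/
lemma sum_dualTerm_sub (m j : ℕ) (hj : j ≤ m) :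
    ∑ k ∈ range (j + 1), ((3 * (m + 1 : ℕ) + 1 - 6 * k) * dualBase (m + 1) k ^ 3
        - (3 * m + 1 - 6 * k) * dualBase m k ^ 3) =
      -((1 / 3 + j) ^ 3 * (3 * j - 6 * m - 5) / (m + 1) ^ 3) * dualBase m j ^ 3 := by
  induction j with
  | zero =>
    rw [sum_range_one, dualBase_succ_left m 0 (Nat.zero_le _)]
    have h4 : (3 * m + 4 : ℚ) ≠ 0 := by positivity
    push_cast
    rw [sub_zero]
    field_simp
    ring
  | succ j ih =>
    rw [sum_range_succ, ih (by omega), dualBase_succ_left m (j + 1) hj]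
    have e := dualBase_succ_right m j hj
    obtain ⟨r, rfl⟩ := Nat.exists_eq_add_of_le' hj
    push_cast at e ⊢
    have e1 : (r + (j + 1) - j : ℚ) = r + 1 := by ring
    have e2 : (r + (j + 1) - (j + 1) : ℚ) = r := by ring
    rw [e1] at e
    rw [e2]
    have hz : (3 * (r + 1) + 1 : ℚ) ≠ 0 := by positivity
    have hz' : (3 * r + 4 : ℚ) ≠ 0 := by positivity
    have e3 : dualBase (r + (j + 1)) j * (j + 1 / 3) =
        dualBase (r + (j + 1)) (j + 1) * ((j + 1) * (3 * r + 2) / (3 * r + 4)) := by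
      field_simp
      linear_combination (-3) * e
    -- The cube of 1/3 + j is absorbed into the cube of `dualBase`, which then moves from j to j + 1
    -- through e3.
    have e4 : -((1 / 3 + j : ℚ) ^ 3 * (3 * j - 6 * (r + (j + 1)) - 5) / (r + (j + 1) + 1) ^ 3) *
        dualBase (r + (j + 1)) j ^ 3 = -((3 * j - 6 * (r + (j + 1)) - 5) / (r + (j + 1) + 1) ^ 3) *
        (dualBase (r + (j + 1)) j * (j + 1 / 3)) ^ 3 := by ring
    rw [e4, e3]
    have h5 : (r + (j + 1) + 1 : ℚ) ≠ 0 := by positivity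
    field_simp
    ring

/-- The truncated very-well-poised sum at `a = 1 / 3`, transformed into a sum with
parameter `-1 / 3 - m` (a limiting case of Bailey's `₉F₈` transformation). -/
theorem sum_eq_sum_dualTerm (m : ℕ) :
    ∑ k ∈ range (m + 1), (6 * (k : ℚ) + 1) * pochRatio (1 / 3) k ^ 6 =
      ∑ k ∈ range (m + 1), (3 * (m : ℚ) + 1 - 6 * k) * dualBase m k ^ 3 := by
  induction m with
  | zero => simp [dualBase, pochRatio]
  | succ m ih =>
    have h := sum_dualTerm_sub m m le_rfl
    rw [sum_sub_distrib, sub_eq_iff_eq_add] at h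
    rw [sum_range_succ, ih, sum_range_succ _ (m + 1), h, dualBase_self, dualBase_self,
      pochRatio_succ]
    push_cast
    have h5 : (m + 1 : ℚ) ≠ 0 := by positivity
    have h6 : (1 + m : ℚ) ≠ 0 := by positivity
    field_simp
    ring

/-! ### Divisibility by powers of p in the rationals -/

/-- `x ∈ p ^ n ℤ_(p)`. -/
def PadicDvd (p : ℕ) (n : ℤ) (x : ℚ) : Prop :=
  padicNorm p x ≤ (p : ℚ) ^ (-n)

namespace PadicDvd

variable {p : ℕ} [hp : Fact p.Prime] {m n : ℤ} {x y z w : ℚ}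

lemma one_lt_cast : (1 : ℚ) < p := by exact_mod_cast hp.out.one_lt

lemma zero : PadicDvd p n 0 := by
  have := one_lt_cast (p := p)
  simp only [PadicDvd, padicNorm.zero]
  positivity

lemma mono (h : m ≤ n) (hx : PadicDvd p n x) : PadicDvd p m x :=
  hx.trans (zpow_le_zpow_right₀ one_lt_cast.le (by omega))

lemma add (hx : PadicDvd p n x) (hy : PadicDvd p n y) : PadicDvd p n (x + y) :=
  padicNorm.nonarchimedean.trans (max_le hx hy)

omit hp in
lemma neg (hx : PadicDvd p n x) : PadicDvd p n (-x) := by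
  simpa [PadicDvd, padicNorm.neg] using hx

lemma sub (hx : PadicDvd p n x) (hy : PadicDvd p n y) : PadicDvd p n (x - y) := by
  rw [sub_eq_add_neg]; exact hx.add hy.neg

lemma mul (hx : PadicDvd p m x) (hy : PadicDvd p n y) : PadicDvd p (m + n) (x * y) := by
  have h0 := one_lt_cast (p := p)
  rw [PadicDvd, padicNorm.mul, neg_add, zpow_add₀ (by positivity)]
  exact mul_le_mul hx hy (padicNorm.nonneg _) (by positivity)

lemma mul_of_nonneg (h : PadicDvd p 0 x) (hy : PadicDvd p n y) : PadicDvd p n (x * y) := by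
  simpa using h.mul hy

lemma sum {ι : Type*} {s : Finset ι} {f : ι → ℚ} (h : ∀ i ∈ s, PadicDvd p n (f i)) :
    PadicDvd p n (∑ i ∈ s, f i) :=
  sum_induction f (PadicDvd p n) (fun _ _ => add) zero h

lemma intCast (a : ℤ) : PadicDvd p 0 a := by
  simpa [PadicDvd] using padicNorm.of_int a

lemma natCast (a : ℕ) : PadicDvd p 0 a := by
  simpa [PadicDvd] using padicNorm.of_nat a

lemma one : PadicDvd p 0 1 := by simpa using natCast (p := p) 1

lemma pow (hx : PadicDvd p n x) (k : ℕ) : PadicDvd p (k * n) (x ^ k) := by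
  induction k with
  | zero => simpa using one
  | succ k ih =>
    rw [pow_succ, show ((k + 1 : ℕ) : ℤ) * n = k * n + n by push_cast; ring]
    exact ih.mul hx

lemma prod {ι : Type*} {s : Finset ι} {f : ι → ℚ} (h : ∀ i ∈ s, PadicDvd p 0 (f i)) :
    PadicDvd p 0 (∏ i ∈ s, f i) :=
  prod_induction f (PadicDvd p 0) (fun _ _ hx hy => by simpa using hx.mul hy) one h

lemma of_le_padicValRat (h : n ≤ padicValRat p x) : PadicDvd p n x := by
  rcases eq_or_ne x 0 with rfl | hx
  · exact zero
  · rw [PadicDvd, padicNorm.eq_zpow_of_nonzero hx]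
    exact zpow_le_zpow_right₀ one_lt_cast.le (by omega)

lemma le_padicValRat (hx : x ≠ 0) (h : PadicDvd p n x) : n ≤ padicValRat p x := by
  rw [PadicDvd, padicNorm.eq_zpow_of_nonzero hx, zpow_le_zpow_iff_right₀ one_lt_cast] at h
  omega

lemma self : PadicDvd p 1 (p : ℚ) :=
  of_le_padicValRat (by simp [padicValRat.self hp.out.one_lt])

omit hp in
lemma of_norm_eq_one (hx : padicNorm p x = 1) : PadicDvd p 0 x := by
  simp [PadicDvd, hx]

lemma inv_of_norm_eq_one (hx : padicNorm p x = 1) : PadicDvd p 0 x⁻¹ := by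
  have : padicNorm p x⁻¹ = 1 := by
    rw [← one_div, padicNorm.div]; simp [hx]
  exact of_norm_eq_one this

lemma div_of_norm_eq_one (hx : PadicDvd p n x) (hy : padicNorm p y = 1) :
    PadicDvd p n (x / y) := by
  rw [PadicDvd, padicNorm.div, hy, div_one]; exact hx

/-- Congruences may be multiplied. -/
lemma mul_sub_mul (hxy : PadicDvd p n (x - y)) (hzw : PadicDvd p n (z - w))
    (hx : PadicDvd p 0 x) (hw : PadicDvd p 0 w) : PadicDvd p n (x * z - y * w) := by
  have e : x * z - y * w = x * (z - w) + w * (x - y) := by ring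
  rw [e]
  exact (hx.mul_of_nonneg hzw).add (hw.mul_of_nonneg hxy)

lemma prod_sub_prod {ι : Type*} {s : Finset ι} {f g : ι → ℚ}
    (hf : ∀ i ∈ s, PadicDvd p 0 (f i)) (hg : ∀ i ∈ s, PadicDvd p 0 (g i))
    (h : ∀ i ∈ s, PadicDvd p n (f i - g i)) :
    PadicDvd p n (∏ i ∈ s, f i - ∏ i ∈ s, g i) := by
  classical
  induction s using Finset.induction_on with
  | empty => simpa using zero
  | insert a s ha ih =>
    rw [prod_insert ha, prod_insert ha]
    exact mul_sub_mul (h a (mem_insert_self a s))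
      (ih (fun i hi => hf i (mem_insert_of_mem hi)) (fun i hi => hg i (mem_insert_of_mem hi))
        (fun i hi => h i (mem_insert_of_mem hi)))
      (hf a (mem_insert_self a s)) (prod fun i hi => hg i (mem_insert_of_mem hi))

lemma norm_eq_one_add (hx : padicNorm p x = 1) (hy : PadicDvd p 1 y) :
    padicNorm p (x + y) = 1 := by
  have hlt : padicNorm p y < 1 := by
    refine lt_of_le_of_lt hy ?_
    rw [zpow_neg_one]
    exact inv_lt_one_of_one_lt₀ one_lt_cast
  rw [padicNorm.add_eq_max_of_ne (by rw [hx]; exact hlt.ne'), hx, max_eq_left hlt.le]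

lemma norm_natCast_eq_one {a : ℕ} (ha : ¬ p ∣ a) : padicNorm p (a : ℚ) = 1 :=
  (padicNorm.nat_eq_one_iff a).2 ha

end PadicDvd

open PadicDvd

lemma not_dvd_den_of_padicDvd {p : ℕ} [hp : Fact p.Prime] {x : ℚ} :
    PadicDvd p 0 x → ¬ p ∣ x.den := by
  intro h hd
  rcases eq_or_ne x 0 with rfl | hx
  · simp at hd; exact hp.out.one_lt.ne' hd
  · have h1 := le_padicValRat hx h
    have h2 : ¬ (p : ℤ) ∣ x.num := by
      intro h3
      have := Nat.dvd_gcd (Int.natCast_dvd.1 h3) hd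
      rw [x.reduced] at this
      exact hp.out.one_lt.ne' (Nat.dvd_one.1 this)
    rw [padicValRat_def, padicValInt.eq_zero_of_not_dvd h2] at h1
    have : 1 ≤ padicValNat p x.den :=
      one_le_padicValNat_of_dvd x.den_nz hd
    omega

lemma pow_dvd_num_of_padicDvd {p : ℕ} [hp : Fact p.Prime] {n : ℕ} {x : ℚ} (h : PadicDvd p n x) :
    ((p ^ n : ℕ) : ℤ) ∣ x.num := by
  rcases eq_or_ne x 0 with rfl | hx
  · simp
  · have h1 := le_padicValRat hx h
    have h2 := not_dvd_den_of_padicDvd (h.mono (by omega))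
    rw [padicValRat_def, padicValNat.eq_zero_of_not_dvd h2] at h1
    have := (padicValInt_dvd_iff (p := p) n x.num).2 (Or.inr (by omega))
    exact_mod_cast this

theorem ratModEq_of_padicDvd {p : ℕ} [hp : Fact p.Prime] {n : ℕ} {x y : ℚ}
    (hy : PadicDvd p 0 y) (hxy : PadicDvd p n (x - y)) : RatModEq (p ^ n) x y := by
  have hx : PadicDvd p 0 x := by
    simpa using (hxy.mono (show (0 : ℤ) ≤ n by omega)).add hy
  have key : ∀ z : ℚ, PadicDvd p 0 z → z.den.Coprime (p ^ n) := fun z hz =>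
    Nat.Coprime.pow_right n ((hp.out.coprime_iff_not_dvd.2 (not_dvd_den_of_padicDvd hz)).symm)
  exact ⟨key x hx, key y hy, pow_dvd_num_of_padicDvd hxy⟩

/-! ### Valuations of (1/3)_k / k! and (2/3)_k / k! -/

lemma padicValNat_eq_sum_pow_dvd {p n s : ℕ} [hp : Fact p.Prime] (hn : 0 < n)
    (h : n < p ^ (s + 1)) :
    padicValNat p n = ∑ i ∈ Ico 1 (s + 1), if p ^ i ∣ n then 1 else 0 := by
  rw [← Nat.factorization_def n hp.out, Nat.factorization_eq_card_pow_dvd_of_lt hp.out hn h,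
    card_filter]

lemma dvd_three_mul_add_iff {P r c j : ℕ} (h3 : P.Coprime 3)
    (hd : P ∣ 3 * c + r) : P ∣ 3 * j + r ↔ j ≡ c [MOD P] := by
  constructor
  · intro h
    have h1 : 3 * j + r ≡ 3 * c + r [MOD P] :=
      ((Nat.modEq_zero_iff_dvd.2 h).trans (Nat.modEq_zero_iff_dvd.2 hd).symm)
    exact Nat.ModEq.cancel_left_of_coprime h3 (Nat.ModEq.add_right_cancel' r h1)
  · intro h
    have h1 : 3 * j + r ≡ 3 * c + r [MOD P] := (h.mul_left 3).add_right r
    exact Nat.modEq_zero_iff_dvd.1 (h1.trans (Nat.modEq_zero_iff_dvd.2 hd))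

/-- The condition selects one residue class, that of c, and every full block of P consecutive j
contributes exactly one element. The quotient k / P will cancel against Legendre's formula for k!.
-/
lemma sum_dvd_three_mul_add {P r c k : ℕ} (hP : 0 < P) (h3 : P.Coprime 3) (hc : c < P)
    (hd : P ∣ 3 * c + r) :
    (∑ j ∈ range k, if P ∣ 3 * j + r then 1 else 0) =
      k / P + if c < k % P then 1 else 0 := by
  rw [← card_filter]
  have := Nat.count_modEq_card k hP c
  rw [Nat.mod_eq_of_lt hc] at this
  rw [← this, Nat.count_eq_card_filter_range]
  simp_rw [dvd_three_mul_add_iff h3 hd]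

/-- The valuation of `(r / 3)_k / k!`, digit by digit. -/
theorem padicValRat_pochRatio {p r s k : ℕ} [hp : Fact p.Prime] (h3 : p.Coprime 3) {c : ℕ → ℕ}
    (hc : ∀ i, 1 ≤ i → c i < p ^ i ∧ p ^ i ∣ 3 * c i + r) (hr : 0 < r)
    (hk : 3 * k + r ≤ p ^ (s + 1)) :
    padicValRat p (pochRatio (r / 3 : ℚ) k) =
      ∑ i ∈ Ico 1 (s + 1), if c i < k % p ^ i then (1 : ℤ) else 0 := by
  have hp3 : ¬ p ∣ 3 := fun h =>
    hp.out.one_lt.ne' (Nat.dvd_one.1 (h3 ▸ Nat.dvd_gcd dvd_rfl h))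
  have e : pochRatio (r / 3 : ℚ) k =
      ((∏ j ∈ range k, (3 * j + r) : ℕ) : ℚ) / ((3 ^ k * k.factorial : ℕ) : ℚ) := by
    rw [pochRatio, prod_div_distrib, ← factorial_eq_prod, Nat.cast_mul, Nat.cast_pow, div_mul_eq_div_div]
    congr 1
    have h3k : ((3 : ℕ) : ℚ) ^ k = ∏ _j ∈ range k, 3 := by simp
    rw [Nat.cast_prod, eq_div_iff (by positivity), h3k, ← prod_mul_distrib]
    refine prod_congr rfl fun j _ => ?_
    push_cast
    ring
  have hA : (∏ j ∈ range k, (3 * j + r)) ≠ 0 := prod_ne_zero_iff.2 fun j _ => by omega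
  have hvA : padicValNat p (∏ j ∈ range k, (3 * j + r)) =
      ∑ i ∈ Ico 1 (s + 1), (k / p ^ i + if c i < k % p ^ i then 1 else 0) := by
    rw [← Nat.factorization_def _ hp.out, Nat.factorization_prod fun j _ => by omega,
      Finsupp.finsetSum_apply]
    have : ∀ j ∈ range k, (3 * j + r).factorization p =
        ∑ i ∈ Ico 1 (s + 1), if p ^ i ∣ 3 * j + r then 1 else 0 := by
      intro j hj
      rw [mem_range] at hj
      rw [Nat.factorization_def _ hp.out]
      exact padicValNat_eq_sum_pow_dvd (by omega) (by omega)
    rw [sum_congr rfl this, sum_comm]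
    refine sum_congr rfl fun i hi => ?_
    have h1 := (mem_Ico.1 hi).1
    exact sum_dvd_three_mul_add (pow_pos hp.out.pos i) (h3.pow_left i) (hc i h1).1 (hc i h1).2
  have hvB : padicValNat p (3 ^ k * k.factorial) = ∑ i ∈ Ico 1 (s + 1), k / p ^ i := by
    rw [padicValNat.mul (by positivity) (Nat.factorial_ne_zero k), padicValNat.pow,
      padicValNat.eq_zero_of_not_dvd hp3, mul_zero, zero_add]
    refine padicValNat_factorial ?_
    rcases Nat.eq_zero_or_pos k with rfl | h0
    · simp
    · exact Nat.log_lt_of_lt_pow h0.ne' (by omega)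
  rw [e, padicValRat.div (by exact_mod_cast hA) (by positivity), padicValRat.of_nat,
    padicValRat.of_nat, hvA, hvB, sum_add_distrib]
  push_cast
  ring

/-- The residue of `-1 / 3` modulo `p ^ i`, for `p ≡ 2 (mod 3)`. -/
def negThirdRes (p i : ℕ) : ℕ := if Odd i then (2 * p ^ i - 1) / 3 else (p ^ i - 1) / 3

/-- The residue of `-2 / 3` modulo `p ^ i`, for `p ≡ 2 (mod 3)`. -/
def negTwoThirdsRes (p i : ℕ) : ℕ := if Odd i then (p ^ i - 2) / 3 else (2 * p ^ i - 2) / 3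

lemma pow_mod_three {p : ℕ} (h2 : p % 3 = 2) (i : ℕ) :
    p ^ i % 3 = if Odd i then 2 else 1 := by
  induction i with
  | zero => simp
  | succ i ih =>
    rw [pow_succ, Nat.mul_mod, ih, h2]
    by_cases h : Odd i
    · simp [h, Nat.odd_add_one]
    · simp [h, Nat.odd_add_one]

lemma three_mul_negThirdRes {p : ℕ} (h2 : p % 3 = 2) (i : ℕ) :
    3 * negThirdRes p i + 1 = if Odd i then 2 * p ^ i else p ^ i := by
  have := pow_mod_three h2 i
  unfold negThirdRes
  split_ifs at this ⊢ <;> omega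

lemma three_mul_negTwoThirdsRes {p : ℕ} (h2 : p % 3 = 2) (i : ℕ) :
    3 * negTwoThirdsRes p i + 2 = if Odd i then p ^ i else 2 * p ^ i := by
  have := pow_mod_three h2 i
  unfold negTwoThirdsRes
  split_ifs at this ⊢ <;> omega

lemma coprime_three {p : ℕ} (h2 : p % 3 = 2) : p.Coprime 3 := by
  rw [Nat.coprime_comm, Nat.Prime.coprime_iff_not_dvd Nat.prime_three]
  omega

lemma negThirdRes_spec {p : ℕ} [hp : Fact p.Prime] (h2 : p % 3 = 2) (i : ℕ) :
    negThirdRes p i < p ^ i ∧ p ^ i ∣ 3 * negThirdRes p i + 1 := by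
  have h := three_mul_negThirdRes h2 i
  have := pow_pos hp.out.pos i
  rw [h]
  split_ifs at h ⊢ with ho
  · exact ⟨by omega, dvd_mul_left _ _⟩
  · exact ⟨by omega, dvd_rfl⟩

lemma negTwoThirdsRes_spec {p : ℕ} [hp : Fact p.Prime] (h2 : p % 3 = 2) (i : ℕ) :
    negTwoThirdsRes p i < p ^ i ∧ p ^ i ∣ 3 * negTwoThirdsRes p i + 2 := by
  have h := three_mul_negTwoThirdsRes h2 i
  have := pow_pos hp.out.pos i
  rw [h]
  split_ifs at h ⊢ with ho
  · exact ⟨by omega, dvd_rfl⟩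
  · exact ⟨by omega, dvd_mul_left _ _⟩

theorem padicValRat_pochRatio_third {p s k : ℕ} [hp : Fact p.Prime] (h2 : p % 3 = 2)
    (hk : 3 * k + 1 ≤ p ^ (s + 1)) :
    padicValRat p (pochRatio (1 / 3 : ℚ) k) =
      ∑ i ∈ Ico 1 (s + 1), if negThirdRes p i < k % p ^ i then (1 : ℤ) else 0 := by
  simpa using padicValRat_pochRatio (p := p) (r := 1) (s := s) (k := k) (coprime_three h2)
    (c := negThirdRes p) (fun i _ => negThirdRes_spec h2 i) one_pos hk

theorem padicValRat_pochRatio_two_thirds {p s k : ℕ} [hp : Fact p.Prime] (h2 : p % 3 = 2)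
    (hk : 3 * k + 2 ≤ p ^ (s + 1)) :
    padicValRat p (pochRatio (2 / 3 : ℚ) k) =
      ∑ i ∈ Ico 1 (s + 1), if negTwoThirdsRes p i < k % p ^ i then (1 : ℤ) else 0 := by
  simpa using padicValRat_pochRatio (p := p) (r := 2) (s := s) (k := k) (coprime_three h2)
    (c := negTwoThirdsRes p) (fun i _ => negTwoThirdsRes_spec h2 i) two_pos hk

/-! ### Digit estimates and vanishing for s ≥ 3 -/

/-- The `i`-th digit contribution to the valuation of `(1/3)_k (2/3)_j / (k! (1/3)_j)`. -/
def digitVal (p i k j : ℕ) : ℤ :=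
  (if negThirdRes p i < k % p ^ i then 1 else 0) +
    (if negTwoThirdsRes p i < j % p ^ i then 1 else 0) -
    (if negThirdRes p i < j % p ^ i then 1 else 0)

section Digits

variable {p : ℕ} [hp : Fact p.Prime]

/-- Only the residues R, T of k, j modulo P = p^i matter, and they satisfy 3(R + T) + 1 = P t with
few possible t. A negative contribution from T requires i even, and then R is large enough to
compensate; for i odd and R = 0, T is the residue of -1/3, which exceeds that of -2/3. -/
lemma digitVal_ge_of_three_mul_add_one (h2 : p % 3 = 2) {s i k j : ℕ} (hi : i ≤ s)
    (h : 3 * (k + j) + 1 = 2 * p ^ s) :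
    (if Odd i ∧ p ^ i ∣ k then (1 : ℤ) else 0) ≤ digitVal p i k j := by
  have hP : p ^ i ∣ 3 * (k % p ^ i + j % p ^ i) + 1 := by
    have h1 : 3 * (k % p ^ i + j % p ^ i) + 1 ≡ 3 * (k + j) + 1 [MOD p ^ i] :=
      (((Nat.mod_modEq k _).add (Nat.mod_modEq j _)).mul_left 3).add_right 1
    refine (Nat.ModEq.dvd_iff h1 dvd_rfl).2 ?_
    rw [h]
    exact Dvd.dvd.mul_left (pow_dvd_pow p hi) 2
  obtain ⟨t, ht⟩ := hP
  have hpos := pow_pos hp.out.pos i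
  have hk := Nat.mod_lt k hpos
  have hj := Nat.mod_lt j hpos
  have c1 := three_mul_negThirdRes h2 i
  have c2 := three_mul_negTwoThirdsRes h2 i
  have hm := pow_mod_three h2 i
  have hd : p ^ i ∣ k ↔ k % p ^ i = 0 := Nat.dvd_iff_mod_eq_zero
  simp only [hd, digitVal]
  -- Both residues are at most P - 1, so 3(R + T) + 1 < 6P.
  have ht6 : t < 6 := by
    by_contra hcon
    have : p ^ i * 6 ≤ p ^ i * t := Nat.mul_le_mul_left _ (by omega)
    omega
  generalize p ^ i = P at *
  generalize k % P = R at *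
  generalize j % P = T at *
  by_cases ho : Odd i <;> simp only [ho, if_true, if_false, true_and, false_and] at * <;>
    interval_cases t <;> split_ifs <;> omega

/-- Here the residues satisfy R + T = P - 1, so T determines R. The only loss is at i even and T the
residue of -2/3, where R is exactly the residue of -1/3 and the strict inequality just fails. The
gain at T ≡ -1/3 pays for the factor 3j + 1 in the denominator of `dualBase`. -/
lemma digitVal_ge_of_add_eq (h2 : p % 3 = 2) {s i k j : ℕ} (hi : i ≤ s)
    (h : k + j + 1 = p ^ s) :
    (if p ^ i ∣ 3 * j + 1 then (1 : ℤ) else 0) -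
      (if ¬ Odd i ∧ p ^ i ∣ 3 * j + 2 then 1 else 0) ≤ digitVal p i k j := by
  have hP : p ^ i ∣ k % p ^ i + j % p ^ i + 1 := by
    have h1 : k % p ^ i + j % p ^ i + 1 ≡ k + j + 1 [MOD p ^ i] :=
      ((Nat.mod_modEq k _).add (Nat.mod_modEq j _)).add_right 1
    refine (Nat.ModEq.dvd_iff h1 dvd_rfl).2 ?_
    rw [h]
    exact pow_dvd_pow p hi
  obtain ⟨t, ht⟩ := hP
  have hpos := pow_pos hp.out.pos i
  have hk := Nat.mod_lt k hpos
  have hj := Nat.mod_lt j hpos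
  have c1 := three_mul_negThirdRes h2 i
  have c2 := three_mul_negTwoThirdsRes h2 i
  have hm := pow_mod_three h2 i
  have s1 := negThirdRes_spec h2 i
  have s2 := negTwoThirdsRes_spec h2 i
  have h3 := (coprime_three h2).pow_left i
  simp only [dvd_three_mul_add_iff h3 s1.2, dvd_three_mul_add_iff h3 s2.2, Nat.ModEq,
    Nat.mod_eq_of_lt s1.1, Nat.mod_eq_of_lt s2.1, digitVal]
  have ht1 : t = 1 := by
    have h0 : t ≠ 0 := by rintro rfl; simp at ht
    have : t < 2 := by
      by_contra hcon
      have : p ^ i * 2 ≤ p ^ i * t := Nat.mul_le_mul_left _ (by omega)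
      omega
    omega
  subst ht1
  generalize p ^ i = P at *
  generalize k % P = R at *
  generalize j % P = T at *
  clear s1 s2 h3
  by_cases ho : Odd i <;> simp only [ho, if_true, if_false, not_true, not_false_iff, true_and,
    false_and] at * <;> split_ifs <;> omega

lemma sum_odd_le (s v : ℕ) (hv : v ≤ s) :
    (∑ i ∈ Ico 1 (s + 1), if Odd i ∧ i ≤ v then (1 : ℤ) else 0) = ((v + 1) / 2 : ℕ) := by
  induction s generalizing v with
  | zero => simp; omega
  | succ s ih =>
    rw [sum_Ico_succ_top (by omega)]
    rcases Nat.lt_or_ge s v with h | h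
    · have hv' : v = s + 1 := by omega
      subst hv'
      have e : (∑ i ∈ Ico 1 (s + 1), if Odd i ∧ i ≤ s + 1 then (1 : ℤ) else 0) =
          ∑ i ∈ Ico 1 (s + 1), if Odd i ∧ i ≤ s then (1 : ℤ) else 0 := by
        refine sum_congr rfl fun i hi => ?_
        have := (mem_Ico.1 hi).2
        simp [show i ≤ s by omega, show i ≤ s + 1 by omega]
      rw [e, ih s le_rfl]
      by_cases ho : Odd (s + 1)
      · have := Nat.odd_iff.1 ho
        simp [ho]; omega
      · have := Nat.not_odd_iff.1 ho
        simp [ho]; omega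
    · rw [ih v h, if_neg (by omega), add_zero]

lemma sum_even_le (s v : ℕ) (hv : v ≤ s) :
    (∑ i ∈ Ico 1 (s + 1), if ¬ Odd i ∧ i ≤ v then (1 : ℤ) else 0) = (v / 2 : ℕ) := by
  induction s generalizing v with
  | zero => simp; omega
  | succ s ih =>
    rw [sum_Ico_succ_top (by omega)]
    rcases Nat.lt_or_ge s v with h | h
    · have hv' : v = s + 1 := by omega
      subst hv'
      have e : (∑ i ∈ Ico 1 (s + 1), if ¬ Odd i ∧ i ≤ s + 1 then (1 : ℤ) else 0) =
          ∑ i ∈ Ico 1 (s + 1), if ¬ Odd i ∧ i ≤ s then (1 : ℤ) else 0 := by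
        refine sum_congr rfl fun i hi => ?_
        have := (mem_Ico.1 hi).2
        simp [show i ≤ s by omega, show i ≤ s + 1 by omega]
      rw [e, ih s le_rfl]
      by_cases ho : Odd (s + 1)
      · have := Nat.odd_iff.1 ho
        simp [ho]; omega
      · have := Nat.not_odd_iff.1 ho
        simp [ho]; omega
    · rw [ih v h, if_neg (by omega), add_zero]

/-- The witness is the valuation of k capped at s; the cap also covers k = 0. -/
lemma exists_pow_dvd_iff_le (s k : ℕ) : ∃ v ≤ s, ∀ i ≤ s, p ^ i ∣ k ↔ i ≤ v := by
  rcases Nat.eq_zero_or_pos k with rfl | hk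
  · exact ⟨s, le_rfl, fun i hi => by simp [hi]⟩
  · refine ⟨min s (padicValNat p k), min_le_left _ _, fun i hi => ?_⟩
    rw [padicValNat_dvd_iff_le hk.ne', le_min_iff]
    tauto

lemma padicValRat_dualBase (h2 : p % 3 = 2) {s m k : ℕ} (hk : k ≤ m)
    (hm : 3 * m + 2 ≤ p ^ (s + 1)) :
    padicValRat p (dualBase m k) = padicValNat p (3 * m + 1) +
      padicValRat p (pochRatio (1 / 3) m) + ∑ i ∈ Ico 1 (s + 1), digitVal p i k (m - k) -
      padicValNat p (3 * (m - k) + 1) := by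
  have n1 : ∀ j : ℕ, pochRatio (1 / 3 : ℚ) j ≠ 0 := pochRatio_ne_zero (by norm_num)
  have n2 : ∀ j : ℕ, pochRatio (2 / 3 : ℚ) j ≠ 0 := pochRatio_ne_zero (by norm_num)
  have n3 : ∀ j : ℕ, (3 * j + 1 : ℚ) ≠ 0 := fun j => by positivity
  have n4 : ∀ j : ℕ, padicValRat p (3 * j + 1 : ℚ) = padicValNat p (3 * j + 1) := fun j => by
    rw [← padicValRat.of_nat]; push_cast; rfl
  rw [dualBase, padicValRat.mul (mul_ne_zero (mul_ne_zero (n3 _) (n1 _)) (n1 _))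
      (div_ne_zero (n2 _) (mul_ne_zero (n3 _) (n1 _))),
    padicValRat.mul (mul_ne_zero (n3 _) (n1 _)) (n1 _), padicValRat.mul (n3 _) (n1 _),
    padicValRat.div (n2 _) (mul_ne_zero (n3 _) (n1 _)), padicValRat.mul (n3 _) (n1 _), n4, n4,
    padicValRat_pochRatio_third (s := s) (k := k) h2 (by omega),
    padicValRat_pochRatio_third (s := s) (k := m - k) h2 (by omega),
    padicValRat_pochRatio_two_thirds (s := s) (k := m - k) h2 (by omega)]
  simp only [digitVal, sum_add_distrib, sum_sub_distrib]
  ring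

lemma padicValRat_pochRatio_third_nonneg (h2 : p % 3 = 2) {s m : ℕ}
    (hm : 3 * m + 1 ≤ p ^ (s + 1)) : 0 ≤ padicValRat p (pochRatio (1 / 3) m) := by
  rw [padicValRat_pochRatio_third h2 hm]
  exact sum_nonneg fun i _ => by split_ifs <;> norm_num

lemma padicDvd_of_pow_dvd {v : ℕ} {a : ℤ} (h : (p : ℤ) ^ v ∣ a) : PadicDvd p v a := by
  obtain ⟨b, rfl⟩ := h
  have := ((self (p := p)).pow v).mul (intCast (p := p) b)
  simpa using this

variable (p) in
/-- The truncated sum vanishes modulo `p ^ (s + 5)` when `3 m + 1 = 2 p ^ s` and `s ≥ 3`. -/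
theorem padicDvd_sum_of_three_mul_add_one (h2 : p % 3 = 2) (h5 : 5 ≤ p) {s m : ℕ} (hs : 3 ≤ s)
    (hso : Odd s) (hm : 3 * m + 1 = 2 * p ^ s) :
    PadicDvd p (s + 5) (∑ k ∈ range (m + 1), (6 * (k : ℚ) + 1) * pochRatio (1 / 3) k ^ 6) := by
  rw [sum_eq_sum_dualTerm]
  refine PadicDvd.sum fun k hk => ?_
  have hkm : k ≤ m := by have := mem_range.1 hk; omega
  have hq : 5 * p ^ s ≤ p ^ (s + 1) := by
    rw [pow_succ, mul_comm]; exact Nat.mul_le_mul_left _ h5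
  have hq0 : 0 < p ^ s := pow_pos hp.out.pos s
  obtain ⟨v, hvs, hv⟩ := exists_pow_dvd_iff_le (p := p) s k
  obtain ⟨j, rfl⟩ := Nat.exists_eq_add_of_le hkm
  have hval := padicValRat_dualBase h2 (s := s) hkm (by omega)
  rw [Nat.add_sub_cancel_left] at hval
  have hsum : (((v + 1) / 2 : ℕ) : ℤ) ≤ ∑ i ∈ Ico 1 (s + 1), digitVal p i k j := by
    rw [← sum_odd_le s v hvs]
    refine sum_le_sum fun i hi => ?_
    have hi' := mem_Ico.1 hi
    have := digitVal_ge_of_three_mul_add_one h2 (s := s) (i := i) (by omega) hm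
    simpa only [hv i (by omega)] using this
  have h3m : s ≤ padicValNat p (3 * (k + j) + 1) := by
    rw [← padicValNat_dvd_iff_le (by omega), hm]
    exact dvd_mul_left _ _
  -- Since (3j + 1) + 3k = 2p^s, a power of p dividing 3j + 1 also divides k.
  have he : padicValNat p (3 * j + 1) ≤ v := by
    set e := padicValNat p (3 * j + 1) with he
    have hd : p ^ e ∣ 3 * j + 1 := pow_padicValNat_dvd
    have hes : e ≤ s := by
      by_contra hcon
      have h1 : p ^ (s + 1) ∣ 3 * j + 1 := (pow_dvd_pow p (by omega)).trans hd
      have := Nat.le_of_dvd (by omega) h1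
      omega
    rw [← hv e hes]
    have h3k : p ^ e ∣ 3 * k := by
      have h1 : p ^ e ∣ (3 * j + 1) + 3 * k := by
        rw [show (3 * j + 1) + 3 * k = 2 * p ^ s by omega]
        exact (pow_dvd_pow p hes).trans (dvd_mul_left _ _)
      exact (Nat.dvd_add_right hd).1 h1
    exact ((coprime_three h2).pow_left e).dvd_of_dvd_mul_left h3k
  have ha := padicValRat_pochRatio_third_nonneg h2 (s := s) (m := k + j) (by omega)
  have hw : PadicDvd p (s - v + ((v + 1) / 2 : ℕ)) (dualBase (k + j) k) :=
    of_le_padicValRat (by rw [hval]; omega)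
  have hf : PadicDvd p v (3 * ((k + j : ℕ) : ℚ) + 1 - 6 * k) := by
    have e : (3 * ((k + j : ℕ) : ℚ) + 1 - 6 * k) = ((2 * p ^ s - 6 * k : ℤ) : ℚ) := by
      have : (3 * ((k + j : ℕ) : ℚ) + 1) = 2 * p ^ s := by exact_mod_cast hm
      rw [this]; push_cast; ring
    rw [e]
    refine padicDvd_of_pow_dvd (dvd_sub ?_ ?_)
    · exact (pow_dvd_pow (p : ℤ) hvs).mul_left 2
    · have : p ^ v ∣ k := (hv v hvs).2 le_rfl
      exact Dvd.dvd.mul_left (by exact_mod_cast this) 6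
  -- The exponent is v + 3(s - ⌊v/2⌋). Its excess over s is 2s + v - 3⌊v/2⌋, least at v = s - 1,
  -- where it is (3s + 1)/2 ≥ 5, with equality at s = 3.
  refine (hf.mul (hw.pow 3)).mono ?_
  have := Nat.odd_iff.1 hso
  push_cast
  omega

variable (p) in
/-- The truncated sum vanishes modulo `p ^ (s + 5)` when `m = p ^ s - 1` and `s ≥ 3`. -/
theorem padicDvd_sum_of_add_one_eq (h2 : p % 3 = 2) (h5 : 5 ≤ p) {s m : ℕ} (hs : 3 ≤ s)
    (hm : m + 1 = p ^ s) :
    PadicDvd p (s + 5) (∑ k ∈ range (m + 1), (6 * (k : ℚ) + 1) * pochRatio (1 / 3) k ^ 6) := by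
  rw [sum_eq_sum_dualTerm]
  refine PadicDvd.sum fun k hk => ?_
  have hkm : k ≤ m := by have := mem_range.1 hk; omega
  have hq : 5 * p ^ s ≤ p ^ (s + 1) := by
    rw [pow_succ, mul_comm]; exact Nat.mul_le_mul_left _ h5
  have hq0 : 0 < p ^ s := pow_pos hp.out.pos s
  obtain ⟨j, rfl⟩ := Nat.exists_eq_add_of_le hkm
  obtain ⟨f, hfs, hf⟩ := exists_pow_dvd_iff_le (p := p) s (3 * j + 2)
  have hval := padicValRat_dualBase h2 (s := s) hkm (by omega)
  rw [Nat.add_sub_cancel_left] at hval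
  have hsum : (padicValNat p (3 * j + 1) : ℤ) - ((f / 2 : ℕ) : ℤ) ≤
      ∑ i ∈ Ico 1 (s + 1), digitVal p i k j := by
    rw [← sum_even_le s f hfs, padicValNat_eq_sum_pow_dvd (s := s) (by omega) (by omega)]
    push_cast
    rw [← sum_sub_distrib]
    refine sum_le_sum fun i hi => ?_
    have hi' := mem_Ico.1 hi
    have := digitVal_ge_of_add_eq h2 (s := s) (i := i) (by omega) hm
    simpa only [hf i (by omega)] using this
  -- All base-p digits of p^s - 1 are maximal, so every i from 1 to s contributes 1.
  have ha : padicValRat p (pochRatio (1 / 3) (k + j)) = s := by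
    rw [padicValRat_pochRatio_third (s := s) h2 (by omega)]
    rw [sum_congr rfl (g := fun _ => (1 : ℤ))]
    · simp
    · intro i hi
      have hi' := mem_Ico.1 hi
      have c1 := three_mul_negThirdRes h2 i
      have hpi : 5 ≤ p ^ i := h5.trans (Nat.le_self_pow (by omega) p)
      have hmod : (k + j) % p ^ i = p ^ i - 1 := by
        obtain ⟨u, hu⟩ := pow_dvd_pow p (show i ≤ s by omega)
        have hu0 : u ≠ 0 := by rintro rfl; omega
        obtain ⟨u, rfl⟩ := Nat.exists_eq_succ_of_ne_zero hu0
        have : k + j = (p ^ i - 1) + p ^ i * u := by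
          rw [Nat.mul_succ] at hu
          omega
        rw [this, Nat.add_mul_mod_self_left, Nat.mod_eq_of_lt (by omega)]
      rw [hmod, if_pos]
      split_ifs at c1 <;> omega
  have hw : PadicDvd p (s - (f / 2 : ℕ)) (dualBase (k + j) k) :=
    of_le_padicValRat (by rw [hval, ha]; omega)
  have hf' : PadicDvd p f (3 * ((k + j : ℕ) : ℚ) + 1 - 6 * k) := by
    have e : (3 * ((k + j : ℕ) : ℚ) + 1 - 6 * k) = ((2 * (3 * j + 2 : ℕ) - 3 * p ^ s : ℤ) : ℚ) := by
      have : (((k + j : ℕ) : ℚ) + 1) = p ^ s := by exact_mod_cast hm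
      push_cast at this ⊢
      rw [← this]; ring
    rw [e]
    refine padicDvd_of_pow_dvd (dvd_sub ?_ ?_)
    · have : p ^ f ∣ 3 * j + 2 := (hf f hfs).2 le_rfl
      exact Dvd.dvd.mul_left (by exact_mod_cast this) 2
    · exact (pow_dvd_pow (p : ℤ) hfs).mul_left 3
  -- The exponent is f + 3(s - ⌊f/2⌋) with f ≤ s, which is at least s + 5 for s ≥ 3; s = 3, f = 2
  -- gives equality.
  refine (hf'.mul (hw.pow 3)).mono ?_
  push_cast
  omega

-- For i ≤ s, p^i divides 3m + 1, so m reduces to the residue of -1/3; for odd i this exceeds the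
-- residue of -2/3 and contributes 1. There are (s + 1)/2 odd i up to s when s is odd.
variable (p) in
lemma le_padicValRat_pochRatio_two_thirds (h2 : p % 3 = 2) (h5 : 5 ≤ p) {s m : ℕ}
    (hm : 3 * m + 1 = 2 * p ^ s) :
    ((s + 1) / 2 : ℕ) ≤ padicValRat p (pochRatio (2 / 3) m) := by
  have hq : 5 * p ^ s ≤ p ^ (s + 1) := by
    rw [pow_succ, mul_comm]; exact Nat.mul_le_mul_left _ h5
  have hq0 : 0 < p ^ s := pow_pos hp.out.pos s
  rw [padicValRat_pochRatio_two_thirds (s := s) h2 (by omega), ← sum_odd_le s s le_rfl]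
  refine sum_le_sum fun i hi => ?_
  have hi' := mem_Ico.1 hi
  by_cases ho : Odd i
  · have c1 := three_mul_negThirdRes h2 i
    have c2 := three_mul_negTwoThirdsRes h2 i
    have s1 := negThirdRes_spec h2 i
    have hpi : 5 ≤ p ^ i := h5.trans (Nat.le_self_pow (by omega) p)
    have hd : p ^ i ∣ 3 * m + 1 := by
      rw [hm]; exact (pow_dvd_pow p (by omega)).trans (dvd_mul_left _ _)
    rw [dvd_three_mul_add_iff ((coprime_three h2).pow_left i) s1.2, Nat.ModEq,
      Nat.mod_eq_of_lt s1.1] at hd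
    rw [hd]
    simp only [ho, if_true] at c1 c2
    simp only [ho, true_and]
    split_ifs <;> omega
  · simp only [ho, false_and, if_false]
    split_ifs <;> norm_num

end Digits

/-! ### Dougall's summation formula -/

/-- The `k`-th term of the terminating very-well-poised `₇F₆` series with `a = 1 / 3` and
parameters `b, c, d, e, -n`. -/
noncomputable def dougallTerm {K : Type*} [Field K] (b c d e : K) (n k : ℕ) : K :=
  (6 * k + 1) * ∏ j ∈ range k,
    ((1 / 3 + j) * (b + j) * (c + j) * (d + j) * (e + j) * (j - n)) /
    ((1 + j) * (4 / 3 - b + j) * (4 / 3 - c + j) * (4 / 3 - d + j) *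
      (4 / 3 - e + j) * (4 / 3 + n + j))

section Dougall

variable {K : Type*} [Field K] [CharZero K]

-- The telescoping relation `dougallTerm_sub` with denominators cleared; it is applied with n + 1 in
-- place of n.
set_option maxRecDepth 10000 in
lemma dougall_certificate (b c d e n k : K) (he : e = 2 / 3 + n - b - c - d) :
    n * (k * (k + 1 / 3) + e * (1 / 3 - e)) * (1 / 3 + 2 * k) *
        ((1 / 3 - b + n) * (1 / 3 - c + n) * (1 / 3 - d + n)) +
      (1 / 3 - b - c + n) * (1 / 3 - b - d + n) * (1 / 3 - c - d + n) * e *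
        (1 / 3 + 2 * k) * (n * (n + 1 / 3) - k * (k + 1 / 3)) =
      (n + e) * ((1 / 3 + k) * (b + k) * (c + k) * (d + k) * (e + k) * (n - k) +
        k * (k + 1 / 3 - b) * (k + 1 / 3 - c) * (k + 1 / 3 - d) * (k + 1 / 3 - e) *
          (n + 1 / 3 + k)) := by
  subst he
  ring

lemma ratCast_ne_zero_of_pos {r : ℚ} (hr : 0 < r) : (r : K) ≠ 0 := by
  rw [Rat.cast_ne_zero]; exact hr.ne'

omit [CharZero K] in
lemma add_ne_zero_of_irrational {x : K} (hx : ∀ r : ℚ, x ≠ r) (r : ℚ) : x + r ≠ 0 := fun h =>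
  hx (-r) (by push_cast; exact eq_neg_of_add_eq_zero_left h)

omit [CharZero K] in
lemma sub_ne_zero_of_irrational {x : K} (hx : ∀ r : ℚ, x ≠ r) (r : ℚ) : (r : K) - x ≠ 0 := fun h =>
  hx r (sub_eq_zero.1 h).symm

variable {b c d e : K}

/-- The part of the term ratio of `dougallTerm` that does not involve `e` and `n`. -/
noncomputable def dougallFactor (b c d : K) (k : ℕ) : K :=
  (6 * k + 7) / (6 * k + 1) * (((1 / 3 + k) * (b + k) * (c + k) * (d + k)) /
    ((1 + k) * (4 / 3 - b + k) * (4 / 3 - c + k) * (4 / 3 - d + k)))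

lemma dougallTerm_succ (b c d e : K) (n k : ℕ) :
    dougallTerm b c d e n (k + 1) = dougallTerm b c d e n k * (dougallFactor b c d k *
      (((e + k) * (k - n)) / ((4 / 3 - e + k) * (4 / 3 + n + k)))) := by
  have h : (6 * k + 1 : K) ≠ 0 := by exact_mod_cast (by omega : 6 * k + 1 ≠ 0)
  rw [dougallTerm, prod_range_succ, dougallTerm, dougallFactor, mul_assoc, mul_assoc _ (_ / _),
    div_mul_div_comm, ← mul_assoc _ (e + k : K), ← mul_assoc _ (4 / 3 - e + k : K)]
  generalize ((1 / 3 + k) * (b + k) * (c + k) * (d + k) * (e + k) * (k - n) / _ : K) = q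
  generalize ∏ j ∈ range k, (_ : K) = P
  push_cast
  field_simp
  ring

omit [CharZero K] in
lemma dougallTerm_eq_zero (b c d e : K) {n k : ℕ} (h : n < k) : dougallTerm b c d e n k = 0 := by
  rw [dougallTerm, prod_eq_zero (mem_range.2 h) (by simp), mul_zero]

/-- Raising e and n by 1 shifts the products that involve them by one factor, so only end factors
survive. The cross-multiplied form also covers k = n + 1, where both sides are 0. -/
lemma dougallTerm_shift (he : ∀ r : ℚ, e ≠ r) (n k : ℕ) :
    dougallTerm b c d e n k * ((e + k) * (1 / 3 - e + k) * ((n + 1) * (n + 1 + 1 / 3))) =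
      dougallTerm b c d (e + 1) (n + 1) k *
        ((n + 1 - k) * (n + 1 + 1 / 3 + k) * (e * (1 / 3 - e))) := by
  induction k with
  | zero =>
    simp [dougallTerm]
    ring
  | succ k ih =>
    have h1 : e + k ≠ 0 := by
      simpa using add_ne_zero_of_irrational he (k : ℚ)
    have h2 : 1 / 3 - e + k ≠ 0 := by
      have := sub_ne_zero_of_irrational he (1 / 3 + k : ℚ)
      push_cast at this
      convert this using 1; ring
    have h3 : 4 / 3 - e + k ≠ 0 := by
      have := sub_ne_zero_of_irrational he (4 / 3 + k : ℚ)
      push_cast at this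
      convert this using 1; ring
    have h4 : (4 / 3 + n + k : K) ≠ 0 := by
      have := ratCast_ne_zero_of_pos (K := K) (r := 4 / 3 + n + k) (by positivity)
      push_cast at this
      exact this
    have h5 : (4 / 3 + (n + 1) + k : K) ≠ 0 := by
      have := ratCast_ne_zero_of_pos (K := K) (r := 4 / 3 + (n + 1) + k) (by positivity)
      push_cast at this
      exact this
    have h6 : (n + 1 : K) ≠ 0 := by exact_mod_cast n.succ_ne_zero
    have h7 : (n + 1 + 1 / 3 : K) ≠ 0 := by
      have := ratCast_ne_zero_of_pos (K := K) (r := n + 1 + 1 / 3) (by positivity)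
      push_cast at this
      exact this
    rw [dougallTerm_succ, dougallTerm_succ]
    generalize dougallTerm b c d e n k = t at *
    generalize dougallTerm b c d (e + 1) (n + 1) k = u at *
    generalize dougallFactor b c d k = g
    push_cast
    have e1 : (4 / 3 - (e + 1) + k : K) = 1 / 3 - e + k := by ring
    have e2 : (1 / 3 - e + (k + 1) : K) = 4 / 3 - e + k := by ring
    have e3 : (n + 1 + 1 / 3 + (k + 1) : K) = 4 / 3 + (n + 1) + k := by ring
    have e4 : (n + 1 + 1 / 3 + k : K) = 4 / 3 + n + k := by ring
    have e5 : (n + 1 - (k + 1) : K) = n - k := by ring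
    rw [e4] at ih
    rw [e1, e2, e3, e5]
    generalize (1 / 3 - e + k : K) = D at *
    generalize (4 / 3 - e + k : K) = D' at *
    generalize (4 / 3 + n + k : K) = A at *
    generalize (4 / 3 + (n + 1) + k : K) = A' at *
    generalize ((n + 1) * (n + 1 + 1 / 3) : K) = X at *
    generalize (e * (1 / 3 - e) : K) = Z at *
    have l : t * (g * ((e + k) * (k - n) / (D' * A))) * ((e + (k + 1)) * D' * X) =
        (t * ((e + k) * D * X)) * (g * (k - n) * (e + (k + 1)) / (A * D)) := by
      field_simp
    rw [l, ih]
    field_simp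
    ring

/-- The ratio of consecutive values of Dougall's series, with `N = n + 1`. -/
noncomputable def dougallRatio (b c d e N : K) : K :=
  (1 / 3 + N) * ((1 / 3 - b - c + N) * (1 / 3 - b - d + N) * (1 / 3 - c - d + N)) /
    ((1 / 3 - b + N) * (1 / 3 - c + N) * (1 / 3 - d + N) * (e - 1 / 3))

/-- The antidifference in the telescoping proof of Dougall's formula. -/
noncomputable def dougallAntidiff (b c d e : K) (n k : ℕ) : K :=
  dougallTerm b c d (e + 1) (n + 1) k * ((n + 1 + e) *
    (k * (k + 1 / 3 - b) * (k + 1 / 3 - c) * (k + 1 / 3 - d) * (n + 1 + 1 / 3 + k)) /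
    ((1 / 3 + 2 * k) * (e + k) * ((n + 1) *
      ((1 / 3 - b + (n + 1)) * (1 / 3 - c + (n + 1)) * (1 / 3 - d + (n + 1))))))

/-- A Wilf–Zeilberger pair. The 2-balanced condition ties e to n, so the step n ↦ n + 1 also raises
e by 1. Both values of the antidifference and both terms are rational multiples of one term, and the
relation reduces to `dougall_certificate`. -/
lemma dougallTerm_sub (hb : ∀ r : ℚ, b ≠ r) (hc : ∀ r : ℚ, c ≠ r) (hd : ∀ r : ℚ, d ≠ r)
    (he' : ∀ r : ℚ, e ≠ r) (n k : ℕ) (he : e = 5 / 3 + n - b - c - d) :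
    dougallTerm b c d (e + 1) (n + 1) k -
        dougallRatio b c d e (n + 1) * dougallTerm b c d e n k =
      dougallAntidiff b c d e n k - dougallAntidiff b c d e n (k + 1) := by
  have h1 : e + k ≠ 0 := by simpa using add_ne_zero_of_irrational he' (k : ℚ)
  have h1' : e + (k + 1) ≠ 0 := by simpa using add_ne_zero_of_irrational he' (k + 1 : ℚ)
  have h0 : e - 1 / 3 ≠ 0 := by
    have := add_ne_zero_of_irrational he' (-1 / 3 : ℚ)
    push_cast at this
    convert this using 1; ring
  have key : ∀ x : K, (∀ r : ℚ, x ≠ r) → ∀ m : ℕ, 1 / 3 - x + m ≠ 0 := by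
    intro x hx m
    have := sub_ne_zero_of_irrational hx (1 / 3 + m : ℚ)
    push_cast at this
    convert this using 1; ring
  have key' : ∀ x : K, (∀ r : ℚ, x ≠ r) → ∀ m : ℕ, 4 / 3 - x + m ≠ 0 := by
    intro x hx m
    have := sub_ne_zero_of_irrational hx (4 / 3 + m : ℚ)
    push_cast at this
    convert this using 1; ring
  have h2 := key e he' k
  have h4 : (1 / 3 + 2 * k : K) ≠ 0 := by
    have := ratCast_ne_zero_of_pos (K := K) (r := 1 / 3 + 2 * k) (by positivity)
    push_cast at this
    exact this
  have h6 : (n + 1 : K) ≠ 0 := by exact_mod_cast n.succ_ne_zero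
  have h7 : (n + 1 + 1 / 3 : K) ≠ 0 := by
    have := ratCast_ne_zero_of_pos (K := K) (r := n + 1 + 1 / 3) (by positivity)
    push_cast at this
    exact this
  have hB := key b hb (n + 1)
  have hC := key c hc (n + 1)
  have hD := key d hd (n + 1)
  push_cast at hB hC hD
  -- The factors of the antidifference at k + 1 cancel the denominators of the term ratio; the minus
  -- sign comes from k - (n + 1).
  have hstep : dougallAntidiff b c d e n (k + 1) = -(dougallTerm b c d (e + 1) (n + 1) k *
      ((n + 1 + e) * ((1 / 3 + k) * (b + k) * (c + k) * (d + k) * (n + 1 - k)) /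
      ((1 / 3 + 2 * k) * (1 / 3 - e + k) * ((n + 1) *
      ((1 / 3 - b + (n + 1)) * (1 / 3 - c + (n + 1)) * (1 / 3 - d + (n + 1))))))) := by
    have hb' := key' b hb k
    have hc' := key' c hc k
    have hd' := key' d hd k
    have g1 : (6 * k + 1 : K) ≠ 0 := by exact_mod_cast (by omega : 6 * k + 1 ≠ 0)
    have g2 : (6 * k + 7 : K) ≠ 0 := by exact_mod_cast (by omega : 6 * k + 7 ≠ 0)
    have g3 : (1 + k : K) ≠ 0 := by exact_mod_cast (by omega : 1 + k ≠ 0)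
    have g5 : (4 / 3 + (n + 1) + k : K) ≠ 0 := by
      have := ratCast_ne_zero_of_pos (K := K) (r := 4 / 3 + (n + 1) + k) (by positivity)
      push_cast at this
      exact this
    rw [dougallAntidiff, dougallTerm_succ, dougallFactor]
    push_cast
    rw [show (4 / 3 - (e + 1) + k : K) = 1 / 3 - e + k by ring,
      show (k + 1 + 1 / 3 - b : K) = 4 / 3 - b + k by ring,
      show (k + 1 + 1 / 3 - c : K) = 4 / 3 - c + k by ring,
      show (k + 1 + 1 / 3 - d : K) = 4 / 3 - d + k by ring,
      show (n + 1 + 1 / 3 + (k + 1) : K) = 4 / 3 + (n + 1) + k by ring,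
      show (1 / 3 + 2 * (k + 1) : K) = (6 * k + 7) / 3 by ring,
      show (1 / 3 + 2 * k : K) = (6 * k + 1) / 3 by ring,
      show (e + 1 + k : K) = e + (k + 1) by ring, show (k + 1 : K) = 1 + k by ring]
    rw [show (k + 1 : K) = 1 + k by ring] at h1'
    generalize (1 / 3 - e + k : K) = D at *
    generalize (4 / 3 - b + k : K) = b' at *
    generalize (4 / 3 - c + k : K) = c' at *
    generalize (4 / 3 - d + k : K) = d' at *
    generalize (e + (1 + k) : K) = e' at *
    generalize (4 / 3 + (n + 1) + k : K) = A' at *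
    generalize ((1 / 3 - b + (n + 1)) * (1 / 3 - c + (n + 1)) * (1 / 3 - d + (n + 1)) : K) = Q
    generalize (n + 1 + e : K) = R
    generalize (1 / 3 + k : K) = k₃
    generalize (6 * k + 1 : K) = k₆ at *
    generalize (6 * k + 7 : K) = k₇ at *
    field_simp
    ring
  have ht : dougallTerm b c d e n k = dougallTerm b c d (e + 1) (n + 1) k *
      ((n + 1 - k) * (n + 1 + 1 / 3 + k) * (e * (1 / 3 - e))) /
      ((e + k) * (1 / 3 - e + k) * ((n + 1) * (n + 1 + 1 / 3))) := by
    rw [eq_div_iff (mul_ne_zero (mul_ne_zero h1 h2) (mul_ne_zero h6 h7))]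
    exact dougallTerm_shift he' n k
  have cert := dougall_certificate b c d e (n + 1) k (by rw [he]; ring)
  rw [hstep, ht, dougallAntidiff, dougallRatio]
  generalize dougallTerm b c d (e + 1) (n + 1) k = u
  generalize (n + 1 : K) = N at *
  generalize hX : (1 / 3 - b - c + N) * (1 / 3 - b - d + N) * (1 / 3 - c - d + N) = X at *
  generalize hQ : (1 / 3 - b + N) * (1 / 3 - c + N) * (1 / 3 - d + N) = Q at *
  have hQ0 : Q ≠ 0 := by rw [← hQ]; exact mul_ne_zero (mul_ne_zero hB hC) hD
  rw [show (1 / 3 + N : K) = N + 1 / 3 by ring]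
  have l : u - (N + 1 / 3) * X / (Q * (e - 1 / 3)) *
      (u * ((N - k) * (N + 1 / 3 + k) * (e * (1 / 3 - e))) /
        ((e + k) * (1 / 3 - e + k) * (N * (N + 1 / 3)))) =
      u * (N * (k * (k + 1 / 3) + e * (1 / 3 - e)) * (1 / 3 + 2 * k) * Q +
        X * e * (1 / 3 + 2 * k) * (N * (N + 1 / 3) - k * (k + 1 / 3))) /
      ((1 / 3 + 2 * k) * (e + k) * (1 / 3 - e + k) * (N * Q)) := by
    rw [show N * (k * (k + 1 / 3) + e * (1 / 3 - e)) = N * ((e + k) * (1 / 3 - e + k)) by ring,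
      show N * (N + 1 / 3) - k * (k + 1 / 3) = (N - k) * (N + 1 / 3 + k) by ring,
      show (1 / 3 - e : K) = -(e - 1 / 3) by ring]
    rw [show (1 / 3 - e : K) = -(e - 1 / 3) by ring] at h2
    generalize (e - 1 / 3 : K) = E at *
    generalize (e + k : K) = E' at *
    generalize (-E + k : K) = D at *
    generalize (1 / 3 + 2 * k : K) = T at *
    generalize (N + 1 / 3 : K) = N₃ at *
    field_simp
    ring
  rw [l, cert]
  rw [show (k + 1 / 3 - e : K) = 1 / 3 - e + k by ring]
  generalize (1 / 3 - e + k : K) = D at *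
  generalize (e + k : K) = E' at *
  generalize (1 / 3 + 2 * k : K) = T at *
  generalize (1 / 3 + k : K) = k₃
  generalize (k + 1 / 3 - b : K) = b'
  generalize (k + 1 / 3 - c : K) = c'
  generalize (k + 1 / 3 - d : K) = d'
  generalize (N + 1 / 3 + k : K) = A
  field_simp
  ring

lemma sum_dougallTerm_succ (hb : ∀ r : ℚ, b ≠ r) (hc : ∀ r : ℚ, c ≠ r) (hd : ∀ r : ℚ, d ≠ r)
    (he' : ∀ r : ℚ, e ≠ r) (n : ℕ) (he : e = 5 / 3 + n - b - c - d) :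
    ∑ k ∈ range (n + 2), dougallTerm b c d (e + 1) (n + 1) k =
      dougallRatio b c d e (n + 1) * ∑ k ∈ range (n + 1), dougallTerm b c d e n k := by
  have h := sum_range_sub' (dougallAntidiff b c d e n) (n + 2)
  have h0 : ∑ k ∈ range (n + 2), dougallTerm b c d e n k =
      ∑ k ∈ range (n + 1), dougallTerm b c d e n k := by
    rw [sum_range_succ, dougallTerm_eq_zero _ _ _ _ (Nat.lt_succ_self n), add_zero]
  -- Both boundary values vanish: the one at 0 has the factor k, the one at n + 2 a term beyond
  -- termination.
  rw [← sum_congr rfl fun k _ => dougallTerm_sub hb hc hd he' n k he, sum_sub_distrib,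
    ← mul_sum, h0, dougallAntidiff, dougallAntidiff,
    dougallTerm_eq_zero _ _ _ _ (Nat.lt_succ_self (n + 1))] at h
  simp only [CharP.cast_eq_zero, zero_mul, mul_zero, zero_div, sub_self] at h
  exact sub_eq_zero.1 h

/-- Dougall's summation of the terminating very-well-poised 2-balanced `₇F₆` series,
for `a = 1 / 3` and parameters that keep all denominators away from zero. -/
theorem sum_dougallTerm (hb : ∀ r : ℚ, b ≠ r) (hc : ∀ r : ℚ, c ≠ r) (hd : ∀ r : ℚ, d ≠ r)
    (hs : ∀ r : ℚ, b + c + d ≠ r) (n : ℕ) :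
    ∑ k ∈ range (n + 1), dougallTerm b c d (5 / 3 + n - b - c - d) n k =
      ∏ j ∈ range n, ((4 / 3 + j) *
        ((4 / 3 - b - c + j) * (4 / 3 - b - d + j) * (4 / 3 - c - d + j))) /
        ((4 / 3 - b + j) * (4 / 3 - c + j) * (4 / 3 - d + j) * (4 / 3 - b - c - d + j)) := by
  induction n with
  | zero => simp [dougallTerm]
  | succ n ih =>
    have he : ∀ r : ℚ, 5 / 3 + n - b - c - d ≠ r := by
      intro r hr
      refine hs (5 / 3 + n - r) ?_
      push_cast
      rw [← hr]; ring
    have := sum_dougallTerm_succ hb hc hd he n rfl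
    rw [ih] at this
    have e1 : (5 / 3 + (n + 1 : ℕ) - b - c - d : K) = 5 / 3 + n - b - c - d + 1 := by
      push_cast; ring
    rw [prod_range_succ, mul_comm, e1, this, dougallRatio]
    congr 2 <;> ring

end Dougall

/-! ### Perturbation by fifth roots of unity and its closed form -/

/-- The `k`-th term of the series with parameters perturbed by the fifth roots of `-y`. -/
noncomputable def perturbedTerm {K : Type*} [Field K] (y : K) (k : ℕ) : K :=
  (6 * k + 1) * ∏ j ∈ range k,
    ((1 / 3 + j) / (1 + j) * (((1 / 3 + j) ^ 5 - y) / ((1 + j) ^ 5 + y)))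

lemma prod_range_sub_middle {R K : Type*} [Ring R] [CommMonoid K] (f : R → K) (M : ℕ) :
    ∏ j ∈ range (2 * M + 1), f ((j : R) - M) =
      f 0 * ∏ i ∈ range M, (f (i + 1) * f (-(i + 1))) := by
  induction M with
  | zero => simp
  | succ M ih =>
    rw [show 2 * (M + 1) + 1 = (2 * M + 1) + 1 + 1 by ring, prod_range_succ, prod_range_succ',
      prod_range_succ _ M, ← mul_assoc (f 0), ← ih]
    have e : ∀ j : ℕ, (((j + 1 : ℕ) : R) - (M + 1 : ℕ)) = j - M := fun j => by push_cast; abel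
    simp only [e]
    have e1 : (((2 * M + 1 : ℕ) : R) - M) = M + 1 := by
      push_cast; rw [two_mul]; abel
    have e2 : (((0 : ℕ) : R) - (M + 1 : ℕ)) = -(M + 1) := by push_cast; abel
    rw [e1, e2, mul_assoc, mul_comm (f (-(M + 1)))]

section FifthRoots

variable {K : Type*} [Field K] {ζ : K}

lemma prod_sub_fifth_roots (hζ : 1 + ζ + ζ ^ 2 + ζ ^ 3 + ζ ^ 4 = 0) (X w : K) :
    (X - w * ζ) * (X - w * ζ ^ 2) * (X - w * ζ ^ 3) * (X - w * ζ ^ 4) * (X - w) =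
      X ^ 5 - w ^ 5 := by
  have h5 : ζ ^ 5 = 1 := by linear_combination (ζ - 1) * hζ
  have e1 : (X - w * ζ) * (X - w * ζ ^ 4) = X ^ 2 - w * (ζ + ζ ^ 4) * X + w ^ 2 := by
    linear_combination w ^ 2 * h5
  have e2 : (X - w * ζ ^ 2) * (X - w * ζ ^ 3) = X ^ 2 - w * (ζ ^ 2 + ζ ^ 3) * X + w ^ 2 := by
    linear_combination w ^ 2 * h5
  have hs : ζ ^ 2 + ζ ^ 3 = -1 - (ζ + ζ ^ 4) := by linear_combination hζ
  have hp : (ζ + ζ ^ 4) ^ 2 = 1 - (ζ + ζ ^ 4) := by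
    linear_combination hζ + (ζ ^ 3 + 2) * h5
  calc _ = ((X - w * ζ) * (X - w * ζ ^ 4)) * ((X - w * ζ ^ 2) * (X - w * ζ ^ 3)) * (X - w) := by
        ring
    _ = _ := by
        rw [e1, e2, hs]
        linear_combination (-w ^ 2 * X ^ 2 * (X - w)) * hp

/-- The resolvent factor in the evaluation of the perturbed series. -/
def resolventFactor (ζ c X : K) : K :=
  (X + c * (1 + 2 * ζ + 2 * ζ ^ 2)) * (X + c * (1 + 2 * ζ + 2 * ζ ^ 3)) *
    (X + c * (1 + 2 * ζ ^ 2 + 2 * ζ ^ 3))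

/-- The product of the first two constants is the third, θ = 1 + 2ζ^2 + 2ζ^3, a square root of 5; so
all three multiply to θ^2 = 5. -/
lemma resolventFactor_zero (hζ : 1 + ζ + ζ ^ 2 + ζ ^ 3 + ζ ^ 4 = 0) (c : K) :
    resolventFactor ζ c 0 = 5 * c ^ 3 := by
  have h5 : ζ ^ 5 = 1 := by linear_combination (ζ - 1) * hζ
  have e : (1 + 2 * ζ + 2 * ζ ^ 2) * (1 + 2 * ζ + 2 * ζ ^ 3) = 1 + 2 * ζ ^ 2 + 2 * ζ ^ 3 := by
    linear_combination 4 * hζ + 4 * h5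
  have e' : (1 + 2 * ζ ^ 2 + 2 * ζ ^ 3) ^ 2 = 5 := by
    linear_combination 4 * hζ + (4 * ζ + 8) * h5
  simp only [resolventFactor, zero_add]
  calc _ = c ^ 3 * (((1 + 2 * ζ + 2 * ζ ^ 2) * (1 + 2 * ζ + 2 * ζ ^ 3)) *
        (1 + 2 * ζ ^ 2 + 2 * ζ ^ 3)) := by ring
    _ = c ^ 3 * (1 + 2 * ζ ^ 2 + 2 * ζ ^ 3) ^ 2 := by rw [e]; ring
    _ = _ := by rw [e']; ring

/-- Pairing X with -X leaves only the squares of the three constants: 5 and two conjugates in ℚ(√5),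
so ζ disappears. -/
lemma resolventFactor_mul_neg (hζ : 1 + ζ + ζ ^ 2 + ζ ^ 3 + ζ ^ 4 = 0) (c X : K) :
    resolventFactor ζ c X * resolventFactor ζ c (-X) =
      -((X ^ 2 - 5 * c ^ 2) * (X ^ 4 + 10 * c ^ 2 * X ^ 2 + 5 * c ^ 4)) := by
  have h5 : ζ ^ 5 = 1 := by linear_combination (ζ - 1) * hζ
  have hs : ζ ^ 2 + ζ ^ 3 = -1 - (ζ + ζ ^ 4) := by linear_combination hζ
  have hp : (ζ + ζ ^ 4) ^ 2 = 1 - (ζ + ζ ^ 4) := by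
    linear_combination hζ + (ζ ^ 3 + 2) * h5
  have e1 : (1 + 2 * ζ + 2 * ζ ^ 2) ^ 2 = -3 + 4 * (ζ ^ 2 + ζ ^ 3) := by
    linear_combination 4 * hζ
  have e2 : (1 + 2 * ζ + 2 * ζ ^ 3) ^ 2 = -3 + 4 * (ζ + ζ ^ 4) := by
    linear_combination 4 * hζ + 4 * ζ * h5
  have e3 : (1 + 2 * ζ ^ 2 + 2 * ζ ^ 3) ^ 2 = 5 := by
    linear_combination 4 * hζ + (4 * ζ + 8) * h5
  calc _ = (c ^ 2 * (1 + 2 * ζ + 2 * ζ ^ 2) ^ 2 - X ^ 2) *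
        (c ^ 2 * (1 + 2 * ζ + 2 * ζ ^ 3) ^ 2 - X ^ 2) *
        (c ^ 2 * (1 + 2 * ζ ^ 2 + 2 * ζ ^ 3) ^ 2 - X ^ 2) := by
        simp only [resolventFactor]; ring
    _ = _ := by
        rw [e1, e2, e3, hs]
        linear_combination (-16 * c ^ 4 * (5 * c ^ 2 - X ^ 2)) * hp

end FifthRoots

lemma fifthRoot_pow_ne_ratCast {ζ : ℂ} (hζ : IsPrimitiveRoot ζ 5) {i : ℕ} (hi : ¬ 5 ∣ i) (r : ℚ) :
    ζ ^ i ≠ r := by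
  intro h
  have h1 : (r : ℂ) ^ 5 = 1 := by
    rw [← h, ← pow_mul, mul_comm, pow_mul, hζ.pow_eq_one, one_pow]
  have h2 : r ^ 5 = 1 := by exact_mod_cast h1
  have h3 : r = 1 := (Odd.strictMono_pow (by decide : Odd 5)).injective (by simpa using h2)
  rw [h3, Rat.cast_one] at h
  exact hi ((hζ.pow_eq_one_iff_dvd i).1 h)

lemma prod_four_thirds (K : Type*) [Field K] [CharZero K] (n : ℕ) :
    ∏ j ∈ range n, (4 / 3 + j : K) = (3 * n + 1) * ∏ j ∈ range n, (1 / 3 + j : K) := by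
  induction n with
  | zero => simp
  | succ n ih =>
    rw [prod_range_succ, ih, prod_range_succ]
    push_cast
    ring

/-- Dougall's formula with n = 2M + 1, w = 2c and parameters 1/3 - w ζ^i for i = 1, …, 4. As n = w -
1/3, the parameter -n is 1/3 - w, which completes the set of fifth roots. Irrationality of the ζ^i
keeps the denominators nonzero. -/
lemma sum_perturbedTerm_complex (M : ℕ) (c : ℂ) (hc : c = M + 2 / 3) :
    ∑ k ∈ range (2 * M + 2), perturbedTerm ((2 * c) ^ 5) k =
      10 * (3 * M + 2) * c ^ 3 *
        (∏ i ∈ range M, -((((i : ℂ) + 1) ^ 2 - 5 * c ^ 2) *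
          (((i : ℂ) + 1) ^ 4 + 10 * c ^ 2 * ((i : ℂ) + 1) ^ 2 + 5 * c ^ 4))) *
        ∏ j ∈ range (2 * M + 1), ((1 + (j : ℂ)) ^ 2 - 4 * c ^ 2) / ((1 + j) ^ 5 + (2 * c) ^ 5) := by
  obtain ⟨ζ, hprim⟩ : ∃ ζ : ℂ, IsPrimitiveRoot ζ 5 := ⟨_, Complex.isPrimitiveRoot_exp 5 (by norm_num)⟩
  have hζ : 1 + ζ + ζ ^ 2 + ζ ^ 3 + ζ ^ 4 = 0 := by
    have := hprim.geom_sum_eq_zero (by norm_num)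
    simpa [sum_range_succ] using this
  set w : ℂ := 2 * c with hw
  have hwr : w = ((2 * M + 4 / 3 : ℚ) : ℂ) := by rw [hw, hc]; push_cast; ring
  have hw0 : w ≠ 0 := by rw [hwr, Rat.cast_ne_zero]; positivity
  have irr : ∀ i : ℕ, ¬ 5 ∣ i → ∀ a r : ℚ, (a : ℂ) - w * ζ ^ i ≠ r := by
    intro i hi a r h
    refine fifthRoot_pow_ne_ratCast hprim hi ((a - r) / (2 * M + 4 / 3)) ?_
    push_cast at hwr ⊢
    rw [← hwr, eq_div_iff hw0, ← h]
    ring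
  have hb : ∀ r : ℚ, 1 / 3 - w * ζ ≠ r := by
    simpa using irr 1 (by norm_num) (1 / 3)
  have hc' : ∀ r : ℚ, 1 / 3 - w * ζ ^ 2 ≠ r := by
    simpa using irr 2 (by norm_num) (1 / 3)
  have hd : ∀ r : ℚ, 1 / 3 - w * ζ ^ 3 ≠ r := by
    simpa using irr 3 (by norm_num) (1 / 3)
  -- The sum of the three parameters is 1 + w + w ζ^4, because the fifth roots of unity sum to zero.
  have hs : ∀ r : ℚ, 1 / 3 - w * ζ + (1 / 3 - w * ζ ^ 2) + (1 / 3 - w * ζ ^ 3) ≠ r := by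
    intro r h
    refine irr 4 (by norm_num) (-1 - (2 * M + 4 / 3)) (-r) ?_
    rw [Rat.cast_sub, ← hwr, Rat.cast_neg r, ← h]
    push_cast
    linear_combination (-w) * hζ
  have key := sum_dougallTerm hb hc' hd hs (2 * M + 1)
  have hterm : ∀ k, dougallTerm (1 / 3 - w * ζ) (1 / 3 - w * ζ ^ 2) (1 / 3 - w * ζ ^ 3)
      (5 / 3 + (2 * M + 1 : ℕ) - (1 / 3 - w * ζ) - (1 / 3 - w * ζ ^ 2) - (1 / 3 - w * ζ ^ 3))
      (2 * M + 1) k = perturbedTerm (w ^ 5) k := by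
    intro k
    rw [dougallTerm, perturbedTerm]
    congr 1
    refine prod_congr rfl fun j _ => ?_
    have hN : ((2 * M + 1 : ℕ) : ℂ) = w - 1 / 3 := by rw [hw, hc]; push_cast; ring
    have he : (5 / 3 + (2 * M + 1 : ℕ) - (1 / 3 - w * ζ) - (1 / 3 - w * ζ ^ 2) -
        (1 / 3 - w * ζ ^ 3) : ℂ) = 1 / 3 - w * ζ ^ 4 := by
      rw [hN]; linear_combination w * hζ
    rw [he, hN, div_mul_div_comm, ← prod_sub_fifth_roots hζ (1 / 3 + j : ℂ) w]
    have h2 := prod_sub_fifth_roots hζ (1 + j : ℂ) (-w)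
    rw [show (1 + j : ℂ) ^ 5 + w ^ 5 = (1 + j : ℂ) ^ 5 - (-w) ^ 5 by ring, ← h2]
    congr 1 <;> ring
  rw [show 2 * M + 2 = 2 * M + 1 + 1 by ring, ← sum_congr rfl fun k _ => hterm k, key,
    prod_div_distrib, prod_mul_distrib, prod_div_distrib]
  have hpos : ∀ j : ℕ, (1 + j : ℂ) ^ 5 + w ^ 5 ≠ 0 := by
    intro j
    have : ((1 + j : ℂ) ^ 5 + w ^ 5) = (((1 + j) ^ 5 + (2 * M + 4 / 3) ^ 5 : ℚ) : ℂ) := by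
      rw [hwr]; push_cast; ring
    rw [this, Rat.cast_ne_zero]
    positivity
  have hQ : ∏ j ∈ range (2 * M + 1), ((1 + j : ℂ) ^ 5 + w ^ 5) ≠ 0 :=
    prod_ne_zero_iff.2 fun j _ => hpos j
  have hodd : (-1 : ℂ) ^ (2 * M + 1) = -1 := Odd.neg_one_pow ⟨M, rfl⟩
  -- Reversing the order turns (1/3)_n into factors -(1 + j - w); the extra factor is 3n + 1 = 2(3M
  -- + 2).
  have hA : ∏ j ∈ range (2 * M + 1), (4 / 3 + j : ℂ) =
      -(2 * (3 * M + 2) * ∏ j ∈ range (2 * M + 1), (1 + j - w : ℂ)) := by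
    rw [prod_four_thirds, ← prod_range_reflect]
    have : ∀ j ∈ range (2 * M + 1), (1 / 3 + ((2 * M + 1 - 1 - j : ℕ) : ℂ)) =
        (-1) * (1 + j - w) := by
      intro j hj
      have hj' := mem_range.1 hj
      rw [Nat.cast_sub (by omega), hw, hc]
      push_cast
      ring
    rw [prod_congr rfl this, prod_mul_distrib, prod_const, card_range, hodd]
    push_cast
    ring
  -- With X = j - M the j-th factor is `resolventFactor ζ c X`, and X runs symmetrically over -M, …,
  -- M.
  have hR : ∏ j ∈ range (2 * M + 1), ((4 / 3 - (1 / 3 - w * ζ) - (1 / 3 - w * ζ ^ 2) + j) *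
      (4 / 3 - (1 / 3 - w * ζ) - (1 / 3 - w * ζ ^ 3) + j) *
      (4 / 3 - (1 / 3 - w * ζ ^ 2) - (1 / 3 - w * ζ ^ 3) + j)) =
      5 * c ^ 3 * ∏ i ∈ range M, -((((i : ℂ) + 1) ^ 2 - 5 * c ^ 2) *
          (((i : ℂ) + 1) ^ 4 + 10 * c ^ 2 * ((i : ℂ) + 1) ^ 2 + 5 * c ^ 4)) := by
    have h1 := prod_congr rfl fun i (_ : i ∈ range M) => resolventFactor_mul_neg hζ c ((i : ℂ) + 1)
    rw [← resolventFactor_zero hζ, ← h1, ← prod_range_sub_middle]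
    refine prod_congr rfl fun j _ => ?_
    have hM : (M : ℂ) = c - 2 / 3 := by rw [hc]; ring
    rw [resolventFactor, hM, hw]
    ring
  -- Reversal turns the last factor into -(1 + j + w ζ^4); the missing fifth factor 1 + j + w is
  -- supplied by hand.
  have hD : (∏ j ∈ range (2 * M + 1), ((4 / 3 - (1 / 3 - w * ζ) + j) *
      (4 / 3 - (1 / 3 - w * ζ ^ 2) + j) * (4 / 3 - (1 / 3 - w * ζ ^ 3) + j) *
      (4 / 3 - (1 / 3 - w * ζ) - (1 / 3 - w * ζ ^ 2) - (1 / 3 - w * ζ ^ 3) + j))) *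
      ∏ j ∈ range (2 * M + 1), (1 + j + w : ℂ) =
      -∏ j ∈ range (2 * M + 1), ((1 + j : ℂ) ^ 5 + w ^ 5) := by
    rw [prod_mul_distrib]
    have e : ∏ j ∈ range (2 * M + 1),
        (4 / 3 - (1 / 3 - w * ζ) - (1 / 3 - w * ζ ^ 2) - (1 / 3 - w * ζ ^ 3) + j : ℂ) =
        -∏ j ∈ range (2 * M + 1), (1 + j + w * ζ ^ 4 : ℂ) := by
      rw [← prod_range_reflect]
      have : ∀ j ∈ range (2 * M + 1), (4 / 3 - (1 / 3 - w * ζ) - (1 / 3 - w * ζ ^ 2) -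
          (1 / 3 - w * ζ ^ 3) + ((2 * M + 1 - 1 - j : ℕ) : ℂ)) = (-1) * (1 + j + w * ζ ^ 4) := by
        intro j hj
        have hj' := mem_range.1 hj
        have hM : (M : ℂ) = (w - 4 / 3) / 2 := by rw [hw, hc]; ring
        rw [Nat.cast_sub (by omega)]
        push_cast
        rw [hM]
        linear_combination w * hζ
      rw [prod_congr rfl this, prod_mul_distrib, prod_const, card_range, hodd]
      ring
    rw [e, mul_neg, neg_mul, ← prod_mul_distrib, ← prod_mul_distrib]
    congr 1
    refine prod_congr rfl fun j _ => ?_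
    have h2 := prod_sub_fifth_roots hζ (1 + j : ℂ) (-w)
    linear_combination h2
  have hF : ∏ j ∈ range (2 * M + 1), ((1 + (j : ℂ)) ^ 2 - 4 * c ^ 2) =
      (∏ j ∈ range (2 * M + 1), (1 + j - w : ℂ)) * ∏ j ∈ range (2 * M + 1), (1 + j + w : ℂ) := by
    rw [← prod_mul_distrib]
    exact prod_congr rfl fun j _ => by rw [hw]; ring
  have aux : ∀ D P₁ P₂ Q t Z : ℂ, D * P₂ = -Q → Q ≠ 0 →
      -(2 * t * P₁) * (5 * c ^ 3 * Z) / D = 10 * t * c ^ 3 * Z * (P₁ * P₂ / Q) := by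
    intro D P₁ P₂ Q t Z h hQ
    have hD0 : D ≠ 0 := by
      rintro rfl
      exact hQ (by simpa using h.symm)
    field_simp
    linear_combination (-10 * t * P₁ * c ^ 3 * Z) * h
  rw [hA, hR, hF]
  exact aux _ _ _ _ _ _ hD hQ

/-- Closed form of the perturbed series. -/
theorem sum_perturbedTerm (M : ℕ) (c : ℚ) (hc : c = M + 2 / 3) :
    ∑ k ∈ range (2 * M + 2), perturbedTerm ((2 * c) ^ 5) k =
      10 * (3 * M + 2) * c ^ 3 *
        (∏ i ∈ range M, -((((i : ℚ) + 1) ^ 2 - 5 * c ^ 2) *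
          (((i : ℚ) + 1) ^ 4 + 10 * c ^ 2 * ((i : ℚ) + 1) ^ 2 + 5 * c ^ 4))) *
        ∏ j ∈ range (2 * M + 1), ((1 + (j : ℚ)) ^ 2 - 4 * c ^ 2) / ((1 + j) ^ 5 + (2 * c) ^ 5) := by
  have h := sum_perturbedTerm_complex M c (by rw [hc]; push_cast; rfl)
  simp only [perturbedTerm] at h ⊢
  apply Rat.cast_injective (α := ℂ)
  push_cast at h ⊢
  exact h

/-! ### Further rules for congruences -/

namespace PadicDvd

variable {p : ℕ} [hp : Fact p.Prime] {n : ℤ} {x y : ℚ}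

lemma pow_sub_pow (hxy : PadicDvd p n (x - y)) (hx : PadicDvd p 0 x) (hy : PadicDvd p 0 y)
    (k : ℕ) : PadicDvd p n (x ^ k - y ^ k) := by
  simpa using prod_sub_prod (s := range k) (f := fun _ => x) (g := fun _ => y)
    (fun _ _ => hx) (fun _ _ => hy) (fun _ _ => hxy)

lemma inv_sub_inv (hxy : PadicDvd p n (x - y)) (hx : padicNorm p x = 1) (hy : padicNorm p y = 1) :
    PadicDvd p n (x⁻¹ - y⁻¹) := by
  have hx0 : x ≠ 0 := by rintro rfl; simp at hx
  have hy0 : y ≠ 0 := by rintro rfl; simp at hy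
  have e : x⁻¹ - y⁻¹ = (-(x - y)) / (x * y) := by field_simp; ring
  rw [e]
  exact hxy.neg.div_of_norm_eq_one (by rw [padicNorm.mul, hx, hy, one_mul])

lemma norm_pow_eq_one (hx : padicNorm p x = 1) (k : ℕ) : padicNorm p (x ^ k) = 1 := by
  induction k with
  | zero => simp
  | succ k ih => rw [pow_succ, padicNorm.mul, ih, hx, one_mul]

end PadicDvd

/-! ### The first-order coefficient and the congruence modulo p^6 -/

section Antisymmetry

lemma sum_range_inv_reflect (N k : ℕ) (hk : k ≤ N) :
    ∑ j ∈ range k, (((N : ℚ) - j) ^ 5)⁻¹ =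
      ∑ j ∈ range N, ((1 + (j : ℚ)) ^ 5)⁻¹ - ∑ j ∈ range (N - k), ((1 + (j : ℚ)) ^ 5)⁻¹ := by
  induction k with
  | zero => simp
  | succ k ih =>
    rw [sum_range_succ, ih (by omega), show N - k = N - (k + 1) + 1 by omega, sum_range_succ,
      Nat.cast_sub hk]
    push_cast
    rw [show (1 + (N - (k + 1)) : ℚ) = N - k by ring]
    ring

lemma prod_neg_sub_div (N k : ℕ) (hk : k ≤ N) :
    ∏ j ∈ range k, (-((N : ℚ) - j) / (1 + j)) = (-1) ^ k * N.choose k := by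
  induction k with
  | zero => simp
  | succ k ih =>
    rw [prod_range_succ, ih (by omega)]
    have h := Nat.choose_succ_right_eq N k
    have h' : (N.choose (k + 1) : ℚ) * (k + 1) = N.choose k * (N - k) := by
      rw [← Nat.cast_sub (by omega : k ≤ N)]
      exact_mod_cast h
    have h0 : (1 + k : ℚ) ≠ 0 := by positivity
    rw [mul_div_assoc', div_eq_iff h0, pow_succ]
    linear_combination (-(-1) ^ k) * (-h')

/-- The reduction of the first-order coefficient sums to zero by the reflection `k ↦ N - k`. -/
lemma sum_antisymm (N : ℕ) :
    ∑ k ∈ range (N + 1), 3 * (2 * (k : ℚ) - N) *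
      (∏ j ∈ range k, (-((N : ℚ) - j) / (1 + j))) ^ 6 *
      ∑ j ∈ range k, (-(((N : ℚ) - j) ^ 5)⁻¹ + ((1 + (j : ℚ)) ^ 5)⁻¹) = 0 := by
  set f : ℕ → ℚ := fun k => 3 * (2 * (k : ℚ) - N) *
      (∏ j ∈ range k, (-((N : ℚ) - j) / (1 + j))) ^ 6 *
      ∑ j ∈ range k, (-(((N : ℚ) - j) ^ 5)⁻¹ + ((1 + (j : ℚ)) ^ 5)⁻¹) with hf
  have hf' : ∀ k ≤ N, f k = 3 * (2 * (k : ℚ) - N) * (N.choose k : ℚ) ^ 6 *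
      (∑ j ∈ range k, ((1 + (j : ℚ)) ^ 5)⁻¹ + ∑ j ∈ range (N - k), ((1 + (j : ℚ)) ^ 5)⁻¹ -
        ∑ j ∈ range N, ((1 + (j : ℚ)) ^ 5)⁻¹) := by
    intro k hk
    simp only [hf]
    rw [prod_neg_sub_div N k hk, sum_add_distrib, sum_neg_distrib, sum_range_inv_reflect N k hk,
      mul_pow, ← pow_mul, mul_comm k 6, pow_mul, show (-1 : ℚ) ^ 6 = 1 by norm_num, one_pow]
    ring
  have hanti : ∀ k ∈ range (N + 1), f (N + 1 - 1 - k) = -f k := by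
    intro k hk
    have hk' : k ≤ N := by have := mem_range.1 hk; omega
    rw [Nat.add_sub_cancel, hf' k hk', hf' (N - k) (Nat.sub_le N k), Nat.sub_sub_self hk',
      Nat.choose_symm hk', Nat.cast_sub hk']
    ring
  have h := sum_range_reflect f (N + 1)
  rw [sum_congr rfl hanti, sum_neg_distrib] at h
  linarith

end Antisymmetry

section PrimeLevel

variable {p M : ℕ} [hp : Fact p.Prime]

lemma norm_one_add_natCast (hM : p = 3 * M + 2) {j : ℕ} (hj : j < 2 * M + 1) :
    padicNorm p (1 + j : ℚ) = 1 := by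
  have : ¬ p ∣ 1 + j := fun h => by
    have := Nat.le_of_dvd (by omega) h
    omega
  have := norm_natCast_eq_one this
  push_cast at this
  exact this

lemma norm_three (hM : p = 3 * M + 2) : padicNorm p (3 : ℚ) = 1 := by
  have : ¬ p ∣ 3 := fun h => by
    have := (Nat.prime_three.eq_one_or_self_of_dvd p h)
    omega
  simpa using norm_natCast_eq_one this

lemma norm_third_add_natCast (hM : p = 3 * M + 2) {j : ℕ} (hj : j < 2 * M + 1) :
    padicNorm p (1 / 3 + j : ℚ) = 1 := by
  have : ¬ p ∣ 3 * j + 1 := fun h => by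
    obtain ⟨t, ht⟩ := h
    have : t < 2 := by
      by_contra hcon
      have : p * 2 ≤ p * t := Nat.mul_le_mul_left _ (by omega)
      omega
    interval_cases t <;> omega
  have h := norm_natCast_eq_one this
  have e : (1 / 3 + j : ℚ) = ((3 * j + 1 : ℕ) : ℚ) / 3 := by push_cast; ring
  rw [e, padicNorm.div, h, norm_three hM, div_one]

lemma padicDvd_third (hM : p = 3 * M + 2) : PadicDvd p 1 ((p : ℚ) / 3) :=
  self.div_of_norm_eq_one (norm_three hM)

lemma padicDvd_pow_five (hM : p = 3 * M + 2) : PadicDvd p 5 ((2 * ((p : ℚ) / 3)) ^ 5) := by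
  have h2 : PadicDvd p 0 (2 : ℚ) := by simpa using natCast (p := p) 2
  simpa using (h2.mul_of_nonneg (padicDvd_third hM)).pow 5

/-- First-order expansion of the perturbed products. -/
lemma padicDvd_perturbed_prod_sub (hM : p = 3 * M + 2) {y : ℚ} (hy : PadicDvd p 5 y) (k : ℕ)
    (hk : k ≤ 2 * M + 1) :
    PadicDvd p 0 (∑ j ∈ range k, (((1 / 3 + j : ℚ) ^ 5)⁻¹ + ((1 + (j : ℚ)) ^ 5)⁻¹)) ∧
    PadicDvd p 0 (pochRatio (1 / 3) k : ℚ) ∧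
    PadicDvd p 6 (∏ j ∈ range k, ((1 / 3 + j : ℚ) / (1 + j) *
        (((1 / 3 + j) ^ 5 - y) / ((1 + j) ^ 5 + y))) -
      pochRatio (1 / 3) k ^ 6 *
        (1 - y * ∑ j ∈ range k, (((1 / 3 + j : ℚ) ^ 5)⁻¹ + ((1 + (j : ℚ)) ^ 5)⁻¹))) := by
  induction k with
  | zero => simpa [pochRatio] using ⟨zero, one, zero⟩
  | succ k ih =>
    obtain ⟨i1, i2, i3⟩ := ih (by omega)
    rw [prod_range_succ, sum_range_succ, pochRatio_succ]
    have hA := norm_third_add_natCast hM (j := k) (by omega)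
    have hB := norm_one_add_natCast hM (j := k) (by omega)
    generalize ∑ j ∈ range k, (((1 / 3 + j : ℚ) ^ 5)⁻¹ + ((1 + (j : ℚ)) ^ 5)⁻¹) = h at *
    generalize ∏ j ∈ range k, ((1 / 3 + j : ℚ) / (1 + j) *
        (((1 / 3 + j) ^ 5 - y) / ((1 + j) ^ 5 + y))) = Q at *
    generalize (pochRatio (1 / 3) k : ℚ) = a at *
    generalize (1 / 3 + k : ℚ) = A at *
    generalize (1 + k : ℚ) = B at *
    have hA5 := norm_pow_eq_one hA 5
    have hB5 := norm_pow_eq_one hB 5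
    have hBy : padicNorm p (B ^ 5 + y) = 1 := norm_eq_one_add hB5 (hy.mono (by norm_num))
    have hB0 : B ≠ 0 := by rintro rfl; simp at hB
    have hA0 : A ≠ 0 := by rintro rfl; simp at hA
    have hBy0 : B ^ 5 + y ≠ 0 := fun h0 => by rw [h0] at hBy; simp at hBy
    have iA := of_norm_eq_one hA
    have iAB : PadicDvd p 0 (A / B) := iA.div_of_norm_eq_one hB
    have iy : PadicDvd p 0 y := hy.mono (by norm_num)
    have iy2 : PadicDvd p 6 (y * y) := (hy.mul hy).mono (by norm_num)
    have ig : PadicDvd p 0 ((A ^ 5)⁻¹ + (B ^ 5)⁻¹) :=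
      (inv_of_norm_eq_one hA5).add (inv_of_norm_eq_one hB5)
    have iA5 := of_norm_eq_one hA5
    have iB5 := of_norm_eq_one hB5
    have iF : PadicDvd p 0 (A / B * ((A ^ 5 - y) / (B ^ 5 + y))) :=
      iAB.mul_of_nonneg ((iA5.sub iy).div_of_norm_eq_one hBy)
    have iAB6 : PadicDvd p 0 ((A / B) ^ 6) := by simpa using iAB.pow 6
    have ia6 : PadicDvd p 0 (a ^ 6) := by simpa using i2.pow 6
    refine ⟨i1.add ig, i2.mul_of_nonneg iAB, ?_⟩
    -- The first-order error of a single factor is an explicit multiple of y^2, hence of p^10.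
    have step : PadicDvd p 6 (A / B * ((A ^ 5 - y) / (B ^ 5 + y)) -
        (A / B) ^ 6 * (1 - y * ((A ^ 5)⁻¹ + (B ^ 5)⁻¹))) := by
      have e : A / B * ((A ^ 5 - y) / (B ^ 5 + y)) -
          (A / B) ^ 6 * (1 - y * ((A ^ 5)⁻¹ + (B ^ 5)⁻¹)) =
          (A / B) * (A ^ 5 + B ^ 5) * (y * y) / ((B ^ 5 + y) * (B ^ 5) ^ 2) := by
        field_simp
        ring
      rw [e]
      refine PadicDvd.div_of_norm_eq_one ((iAB.mul_of_nonneg (iA5.add iB5)).mul_of_nonneg iy2) ?_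
      rw [padicNorm.mul, hBy, norm_pow_eq_one hB5, one_mul]
    have i4 : PadicDvd p 0 (1 - y * h) := one.sub (iy.mul_of_nonneg i1)
    have m := mul_sub_mul i3 step
      (by
        have := (i3.mono (show (0 : ℤ) ≤ 6 by norm_num)).add (ia6.mul_of_nonneg i4)
        simpa using this)
      (iAB6.mul_of_nonneg (one.sub (iy.mul_of_nonneg ig)))
    have e2 : a ^ 6 * (1 - y * h) * ((A / B) ^ 6 * (1 - y * ((A ^ 5)⁻¹ + (B ^ 5)⁻¹))) -
        (a * (A / B)) ^ 6 * (1 - y * (h + ((A ^ 5)⁻¹ + (B ^ 5)⁻¹))) =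
        (a ^ 6 * (A / B) ^ 6 * h * ((A ^ 5)⁻¹ + (B ^ 5)⁻¹)) * (y * y) := by
      ring
    have m2 : PadicDvd p 6 ((a ^ 6 * (A / B) ^ 6 * h * ((A ^ 5)⁻¹ + (B ^ 5)⁻¹)) * (y * y)) :=
      (((ia6.mul_of_nonneg iAB6).mul_of_nonneg i1).mul_of_nonneg ig).mul_of_nonneg iy2
    rw [← e2] at m2
    simpa using m.add m2

/-- As 1/3 + (2M + 1) = 2p/3, one may replace 1/3 by -(2M + 1) modulo p in every summand; the result
is the sum of `sum_antisymm`, which is exactly 0. -/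
lemma padicDvd_sum_first_order (hM : p = 3 * M + 2) :
    PadicDvd p 1 (∑ k ∈ range (2 * M + 2), (6 * (k : ℚ) + 1) * pochRatio (1 / 3) k ^ 6 *
      ∑ j ∈ range k, (((1 / 3 + j : ℚ) ^ 5)⁻¹ + ((1 + (j : ℚ)) ^ 5)⁻¹)) := by
  have h := sum_antisymm (2 * M + 1)
  have hpq : (p : ℚ) = 3 * M + 2 := by rw [hM]; push_cast; ring
  have hp3 := padicDvd_third hM
  have h2 : PadicDvd p 0 (2 : ℚ) := by simpa using natCast (p := p) 2
  have h2p : PadicDvd p 1 (2 * ((p : ℚ) / 3)) := h2.mul_of_nonneg hp3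
  rw [← sub_zero (∑ k ∈ range (2 * M + 2), _), ← h, ← sum_sub_distrib]
  refine PadicDvd.sum fun k hk => ?_
  have hk' : k ≤ 2 * M + 1 := by have := mem_range.1 hk; omega
  have nA : ∀ j ∈ range k, padicNorm p (1 / 3 + j : ℚ) = 1 := fun j hj =>
    norm_third_add_natCast hM (by have := mem_range.1 hj; omega)
  have nB : ∀ j ∈ range k, padicNorm p (1 + j : ℚ) = 1 := fun j hj =>
    norm_one_add_natCast hM (by have := mem_range.1 hj; omega)
  have nN : ∀ j ∈ range k, padicNorm p (-(((2 * M + 1 : ℕ) : ℚ) - j)) = 1 := fun j hj => by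
    have hj' := mem_range.1 hj
    have e : -(((2 * M + 1 : ℕ) : ℚ) - j) = -(1 + (2 * M - j : ℕ)) := by
      rw [Nat.cast_sub (by omega)]; push_cast; ring
    rw [e, padicNorm.neg]
    exact norm_one_add_natCast hM (by omega)
  have hdiff : ∀ j ∈ range k, PadicDvd p 1 ((1 / 3 + j : ℚ) - -(((2 * M + 1 : ℕ) : ℚ) - j)) :=
    fun j _ => by
      convert h2p using 1
      rw [hpq]; push_cast; ring
  have i1 : PadicDvd p 1 (6 * (k : ℚ) + 1 - 3 * (2 * k - (2 * M + 1 : ℕ))) := by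
    convert h2.mul_of_nonneg (self (p := p)) using 1
    rw [hpq]; push_cast; ring
  have j1 : PadicDvd p 0 (6 * (k : ℚ) + 1) := by
    simpa using natCast (p := p) (6 * k + 1)
  have i2 : PadicDvd p 1 (pochRatio (1 / 3) k -
      ∏ j ∈ range k, (-(((2 * M + 1 : ℕ) : ℚ) - j) / (1 + j))) := by
    refine prod_sub_prod (fun j hj => (of_norm_eq_one (nA j hj)).div_of_norm_eq_one (nB j hj))
      (fun j hj => (of_norm_eq_one (nN j hj)).div_of_norm_eq_one (nB j hj)) fun j hj => ?_
    rw [← sub_div]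
    exact (hdiff j hj).div_of_norm_eq_one (nB j hj)
  have j2 : PadicDvd p 0 (pochRatio (1 / 3) k : ℚ) := PadicDvd.prod fun j hj =>
    (of_norm_eq_one (nA j hj)).div_of_norm_eq_one (nB j hj)
  have j2' : PadicDvd p 0 (∏ j ∈ range k, (-(((2 * M + 1 : ℕ) : ℚ) - j) / (1 + j))) :=
    PadicDvd.prod fun j hj => (of_norm_eq_one (nN j hj)).div_of_norm_eq_one (nB j hj)
  have i3 : PadicDvd p 1 (∑ j ∈ range k, (((1 / 3 + j : ℚ) ^ 5)⁻¹ + ((1 + (j : ℚ)) ^ 5)⁻¹) -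
      ∑ j ∈ range k, (-((((2 * M + 1 : ℕ) : ℚ) - j) ^ 5)⁻¹ + ((1 + (j : ℚ)) ^ 5)⁻¹)) := by
    rw [← sum_sub_distrib]
    refine PadicDvd.sum fun j hj => ?_
    have := inv_sub_inv (pow_sub_pow (hdiff j hj) (of_norm_eq_one (nA j hj))
      (of_norm_eq_one (nN j hj)) 5) (norm_pow_eq_one (nA j hj) 5) (norm_pow_eq_one (nN j hj) 5)
    rw [Odd.neg_pow (by decide), inv_neg] at this
    convert this using 1
    ring
  have j3' : PadicDvd p 0 (∑ j ∈ range k,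
      (-((((2 * M + 1 : ℕ) : ℚ) - j) ^ 5)⁻¹ + ((1 + (j : ℚ)) ^ 5)⁻¹)) := by
    refine PadicDvd.sum fun j hj => ?_
    have := inv_of_norm_eq_one (norm_pow_eq_one (nN j hj) 5)
    rw [Odd.neg_pow (by decide), inv_neg] at this
    exact this.add (inv_of_norm_eq_one (norm_pow_eq_one (nB j hj) 5))
  have j26 : PadicDvd p 0 ((pochRatio (1 / 3) k : ℚ) ^ 6) := by simpa using j2.pow 6
  have j26' := j2'.pow 6
  rw [mul_zero] at j26'
  exact mul_sub_mul (mul_sub_mul i1 (pow_sub_pow i2 j2 j2' 6) j1 j26') i3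
    (j1.mul_of_nonneg j26) j3'

/-- The perturbation does not change the sum modulo `p ^ 6`. -/
theorem padicDvd_sum_sub_sum_perturbedTerm (hM : p = 3 * M + 2) {y : ℚ} (hy : PadicDvd p 5 y) :
    PadicDvd p 6 (∑ k ∈ range (2 * M + 2), (6 * (k : ℚ) + 1) * pochRatio (1 / 3) k ^ 6 -
      ∑ k ∈ range (2 * M + 2), perturbedTerm y k) := by
  have h1 := (hy.mul (padicDvd_sum_first_order hM)).mono (show (6 : ℤ) ≤ 5 + 1 by norm_num)
  have h2 : PadicDvd p 6 (∑ k ∈ range (2 * M + 2), (6 * (k : ℚ) + 1) *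
      (∏ j ∈ range k, ((1 / 3 + j : ℚ) / (1 + j) *
        (((1 / 3 + j) ^ 5 - y) / ((1 + j) ^ 5 + y))) -
      pochRatio (1 / 3) k ^ 6 *
        (1 - y * ∑ j ∈ range k, (((1 / 3 + j : ℚ) ^ 5)⁻¹ + ((1 + (j : ℚ)) ^ 5)⁻¹)))) := by
    refine PadicDvd.sum fun k hk => ?_
    have hk' : k ≤ 2 * M + 1 := by have := mem_range.1 hk; omega
    refine PadicDvd.mul_of_nonneg ?_ (padicDvd_perturbed_prod_sub hM hy k hk').2.2
    simpa using natCast (p := p) (6 * k + 1)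
  convert h1.sub h2 using 1
  rw [mul_sum, ← sum_sub_distrib, ← sum_sub_distrib]
  refine sum_congr rfl fun k _ => ?_
  rw [perturbedTerm]
  ring

/-- The factors 2/3 + j = (j - M) + c are centred at c, so pairing opposite ones gives the shape of
the closed form of the perturbed sum. -/
lemma pochRatio_two_thirds_pow (M : ℕ) (c : ℚ) (hc : c = M + 2 / 3) :
    (pochRatio (2 / 3) (2 * M + 1) : ℚ) ^ 3 =
      c ^ 3 * ((∏ i ∈ range M, -(((i : ℚ) + 1) ^ 2 - c ^ 2) ^ 3) *
        ∏ j ∈ range (2 * M + 1), ((1 + (j : ℚ)) ^ 3)⁻¹) := by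
  have h := prod_range_sub_middle (fun X : ℚ => X + c) M
  have e : ∀ j : ℕ, (2 / 3 + j : ℚ) = (j : ℚ) - M + c := fun j => by rw [hc]; ring
  rw [pochRatio, prod_div_distrib]
  simp only [e]
  rw [h, div_pow, mul_pow, ← prod_pow, ← prod_pow, div_eq_mul_inv, ← prod_inv_distrib, zero_add,
    mul_assoc]
  congr 2
  refine prod_congr rfl fun i _ => ?_
  ring

/-- The closed form of the perturbed sum, compared with the right-hand side modulo `p ^ 6`. -/
theorem padicDvd_sum_perturbedTerm_sub (hM : p = 3 * M + 2) :
    PadicDvd p 6 (∑ k ∈ range (2 * M + 2), perturbedTerm ((2 * ((p : ℚ) / 3)) ^ 5) k -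
      10 * (p : ℚ) * pochRatio (2 / 3) (2 * M + 1) ^ 3) := by
  have hpq : (p : ℚ) = 3 * M + 2 := by rw [hM]; push_cast; ring
  have hc : (p : ℚ) / 3 = M + 2 / 3 := by rw [hpq]; ring
  have ic := padicDvd_third hM
  have iy := padicDvd_pow_five hM
  rw [sum_perturbedTerm M _ hc, pochRatio_two_thirds_pow M _ hc, ← hpq]
  generalize (p : ℚ) / 3 = c at *
  have ic0 : PadicDvd p 0 c := ic.mono (by norm_num)
  have ic2 : PadicDvd p 2 (c ^ 2) := by simpa using ic.pow 2
  have ic20 : PadicDvd p 0 (c ^ 2) := ic2.mono (by norm_num)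
  have iN : ∀ n : ℕ, PadicDvd p 0 (n : ℚ) := natCast
  -- The common prefactor carries p^4, so the remaining products need only agree modulo p^2; factor
  -- by factor they differ by multiples of c^2.
  have i4 : PadicDvd p 4 (10 * p * c ^ 3) := by
    simpa using ((iN 10).mul_of_nonneg self).mul (ic.pow 3)
  have iI : ∀ i : ℕ, PadicDvd p 0 (((i : ℚ) + 1) ^ 2) := fun i => by
    exact_mod_cast iN ((i + 1) ^ 2)
  have ic4 : PadicDvd p 0 (c ^ 4) := by simpa using ic0.pow 4
  have d1 : ∀ i ∈ range M, PadicDvd p 2 (-((((i : ℚ) + 1) ^ 2 - 5 * c ^ 2) *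
      (((i : ℚ) + 1) ^ 4 + 10 * c ^ 2 * ((i : ℚ) + 1) ^ 2 + 5 * c ^ 4)) -
      -(((i : ℚ) + 1) ^ 2 - c ^ 2) ^ 3) := by
    intro i _
    have e : -((((i : ℚ) + 1) ^ 2 - 5 * c ^ 2) *
      (((i : ℚ) + 1) ^ 4 + 10 * c ^ 2 * ((i : ℚ) + 1) ^ 2 + 5 * c ^ 4)) -
      -(((i : ℚ) + 1) ^ 2 - c ^ 2) ^ 3 =
      ((((-8 : ℤ) : ℚ) * (((i : ℚ) + 1) ^ 2 * ((i : ℚ) + 1) ^ 2)) +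
        (((48 : ℤ) : ℚ) * (((i : ℚ) + 1) ^ 2 * c ^ 2)) + (((24 : ℤ) : ℚ) * c ^ 4)) * c ^ 2 := by
      push_cast; ring
    rw [e]
    exact ((((intCast _).mul_of_nonneg ((iI i).mul_of_nonneg (iI i))).add
      ((intCast _).mul_of_nonneg ((iI i).mul_of_nonneg ic20))).add
      ((intCast _).mul_of_nonneg ic4)).mul_of_nonneg ic2
  have j1' : ∀ i ∈ range M, PadicDvd p 0 (-(((i : ℚ) + 1) ^ 2 - c ^ 2) ^ 3) := by
    intro i _
    simpa using (((iI i).sub ic20).pow 3).neg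
  have j1 : ∀ i ∈ range M, PadicDvd p 0 (-((((i : ℚ) + 1) ^ 2 - 5 * c ^ 2) *
      (((i : ℚ) + 1) ^ 4 + 10 * c ^ 2 * ((i : ℚ) + 1) ^ 2 + 5 * c ^ 4))) := by
    intro i hi
    simpa using ((d1 i hi).mono (show (0 : ℤ) ≤ 2 by norm_num)).add (j1' i hi)
  have nB : ∀ j ∈ range (2 * M + 1), padicNorm p (1 + j : ℚ) = 1 := fun j hj =>
    norm_one_add_natCast hM (mem_range.1 hj)
  have j2' : ∀ j ∈ range (2 * M + 1), PadicDvd p 0 (((1 + (j : ℚ)) ^ 3)⁻¹) := fun j hj =>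
    inv_of_norm_eq_one (norm_pow_eq_one (nB j hj) 3)
  have d2 : ∀ j ∈ range (2 * M + 1), PadicDvd p 2 (((1 + (j : ℚ)) ^ 2 - 4 * c ^ 2) /
      ((1 + j) ^ 5 + (2 * c) ^ 5) - ((1 + (j : ℚ)) ^ 3)⁻¹) := by
    intro j hj
    have n5 : padicNorm p ((1 + (j : ℚ)) ^ 5 + (2 * c) ^ 5) = 1 :=
      norm_eq_one_add (norm_pow_eq_one (nB j hj) 5) (iy.mono (by norm_num))
    have n3 := norm_pow_eq_one (nB j hj) 3
    have z5 : (1 + (j : ℚ)) ^ 5 + (2 * c) ^ 5 ≠ 0 := fun h0 => by rw [h0] at n5; simp at n5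
    have z3 : (1 + (j : ℚ)) ≠ 0 := by positivity
    have e : ((1 + (j : ℚ)) ^ 2 - 4 * c ^ 2) / ((1 + j) ^ 5 + (2 * c) ^ 5) -
        ((1 + (j : ℚ)) ^ 3)⁻¹ = (((-4 : ℤ) : ℚ) * (1 + j) ^ 3 + ((-32 : ℤ) : ℚ) * c ^ 3) * c ^ 2 /
        (((1 + j) ^ 5 + (2 * c) ^ 5) * (1 + j) ^ 3) := by
      rw [div_sub' z5, div_eq_div_iff z5 (mul_ne_zero z5 (pow_ne_zero 3 z3))]
      field_simp
      push_cast
      ring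
    rw [e]
    refine PadicDvd.div_of_norm_eq_one (PadicDvd.mul_of_nonneg ?_ ic2)
      (by rw [padicNorm.mul, n5, n3, one_mul])
    refine ((intCast _).mul_of_nonneg (of_norm_eq_one n3)).add ((intCast _).mul_of_nonneg ?_)
    simpa using ic0.pow 3
  have j2 : ∀ j ∈ range (2 * M + 1), PadicDvd p 0 (((1 + (j : ℚ)) ^ 2 - 4 * c ^ 2) /
      ((1 + j) ^ 5 + (2 * c) ^ 5)) := by
    intro j hj
    simpa using ((d2 j hj).mono (show (0 : ℤ) ≤ 2 by norm_num)).add (j2' j hj)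
  have main := (i4.mul (mul_sub_mul (prod_sub_prod j1 j1' d1) (prod_sub_prod j2 j2' d2)
    (PadicDvd.prod j1) (PadicDvd.prod j2'))).mono (show (6 : ℤ) ≤ 4 + 2 by norm_num)
  convert main using 1
  ring

end PrimeLevel

/-- The congruence modulo `p ^ 6` for the sum truncated at `(2 p - 1) / 3`. -/
theorem padicDvd_sum_sub_of_prime {p M : ℕ} [hp : Fact p.Prime] (hM : p = 3 * M + 2) :
    PadicDvd p 6 (∑ k ∈ range (2 * M + 2), (6 * (k : ℚ) + 1) * pochRatio (1 / 3) k ^ 6 -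
      10 * (p : ℚ) * pochRatio (2 / 3) (2 * M + 1) ^ 3) := by
  simpa using (padicDvd_sum_sub_sum_perturbedTerm hM (padicDvd_pow_five hM)).add
    (padicDvd_sum_perturbedTerm_sub hM)

/-- For k from 2M + 2 to p - 1 the product (1/3)_k contains the factor 1/3 + (2M + 1) = 2p/3, while
p does not divide k!. -/
lemma padicDvd_sum_sub_sum {p M : ℕ} [hp : Fact p.Prime] (hM : p = 3 * M + 2) (h5 : 5 ≤ p) :
    PadicDvd p 6 (∑ k ∈ range p, (6 * (k : ℚ) + 1) * pochRatio (1 / 3) k ^ 6 -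
      ∑ k ∈ range (2 * M + 2), (6 * (k : ℚ) + 1) * pochRatio (1 / 3) k ^ 6) := by
  rw [← sum_Ico_eq_sub _ (by omega)]
  refine PadicDvd.sum fun k hk => ?_
  have hk' := mem_Ico.1 hk
  have h2 : p % 3 = 2 := by omega
  have hq : 5 * p ≤ p ^ (1 + 1) := by rw [pow_two]; exact Nat.mul_le_mul_right _ h5
  have c1 := three_mul_negThirdRes h2 1
  rw [if_pos (by decide)] at c1
  have ha : PadicDvd p 1 (pochRatio (1 / 3 : ℚ) k) := by
    refine of_le_padicValRat ?_
    rw [padicValRat_pochRatio_third (s := 1) h2 (by omega)]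
    rw [pow_one] at c1
    have : negThirdRes p 1 < k % p ^ 1 := by
      rw [pow_one, Nat.mod_eq_of_lt hk'.2]; omega
    rw [show Ico 1 (1 + 1) = {1} from rfl, sum_singleton, if_pos this]
  have h6 : PadicDvd p 0 (6 * (k : ℚ) + 1) := by simpa using natCast (p := p) (6 * k + 1)
  simpa using h6.mul_of_nonneg (ha.pow 6)

/-! ### Assembly of the cases -/

theorem padicDvd_sum_sub {p s m N : ℕ} [hp : Fact p.Prime] (h2 : p % 3 = 2) (h5 : 5 ≤ p)
    (hs : Odd s) (hN : 3 * N + 1 = 2 * p ^ s) (hm : m = N ∨ m + 1 = p ^ s) :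
    PadicDvd p 0 (10 * (p : ℚ) ^ s * pochRatio (2 / 3) N ^ 3) ∧
    PadicDvd p ((s + 5 : ℕ) : ℤ)
      (∑ k ∈ range (m + 1), (6 * (k : ℚ) + 1) * pochRatio (1 / 3) k ^ 6 -
        10 * (p : ℚ) ^ s * pochRatio (2 / 3) N ^ 3) := by
  have hs' := Nat.odd_iff.1 hs
  have hb := (of_le_padicValRat (le_padicValRat_pochRatio_two_thirds p h2 h5 hN)).pow 3
  have h10 : PadicDvd p 0 (10 : ℚ) := by simpa using natCast (p := p) 10
  have hrhs := (h10.mul_of_nonneg ((self (p := p)).pow s)).mul hb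
  refine ⟨hrhs.mono (by positivity), ?_⟩
  rcases Nat.lt_or_ge s 3 with h3 | h3
  · have hs1 : s = 1 := by omega
    subst hs1
    rw [pow_one] at hN hm ⊢
    have hM : p = 3 * (p / 3) + 2 := by omega
    have hN' : N = 2 * (p / 3) + 1 := by omega
    rw [hN']
    have h := padicDvd_sum_sub_of_prime hM
    rcases hm with hm | hm
    · rw [show m + 1 = 2 * (p / 3) + 2 by omega]
      exact h
    · rw [hm]
      simpa using (padicDvd_sum_sub_sum hM h5).add h
  -- For s ≥ 3 the right-hand side has valuation at least s + 3(s + 1)/2 ≥ s + 6, so each side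
  -- vanishes separately.
  · refine PadicDvd.sub ?_ (hrhs.mono ?_)
    · push_cast
      rcases hm with hm | hm
      · exact padicDvd_sum_of_three_mul_add_one p h2 h5 h3 hs (hm ▸ hN)
      · exact padicDvd_sum_of_add_one_eq p h2 h5 h3 hm
    · push_cast
      omega

/-- The natural-number quotient `(2 * p ^ s - 1) / 3` is exact, because `p ^ s ≡ 2 (mod 3)`. -/
theorem corollary1p6 (p s : ℕ) (hp : p.Prime) (hodd : Odd p) (hs : 0 < s)
    (hmod : p ^ s ≡ 2 [MOD 3]) (m : ℕ)
    (hm : m = (2 * p ^ s - 1) / 3 ∨ m = p ^ s - 1) :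
    RatModEq (p ^ (s + 5))
      (∑ k ∈ Finset.range (m + 1),
        (6 * (k : ℚ) + 1) * (shiftedFactorial (1 / 3) k ^ 6 / (k.factorial : ℚ) ^ 6))
      (10 * (p : ℚ) ^ s *
        (shiftedFactorial (2 / 3) ((2 * p ^ s - 1) / 3) ^ 3 /
          shiftedFactorial 1 ((2 * p ^ s - 1) / 3) ^ 3)) := by
  have : Fact p.Prime := ⟨hp⟩
  have hmod' : p ^ s % 3 = 2 := hmod
  have h2 : p % 3 = 2 := by
    rw [Nat.pow_mod] at hmod'
    have h3 : p % 3 < 3 := Nat.mod_lt p (by norm_num)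
    interval_cases h : p % 3
    · rw [zero_pow hs.ne'] at hmod'; simp at hmod'
    · rw [one_pow] at hmod'; simp at hmod'
    · rfl
  have hso : Odd s := by
    by_contra hcon
    have := pow_mod_three h2 s
    rw [if_neg hcon] at this
    omega
  have h5 : 5 ≤ p := by
    have := Nat.odd_iff.1 hodd
    have := hp.two_le
    omega
  have hpos : 0 < p ^ s := pow_pos hp.pos s
  have main := padicDvd_sum_sub (m := m) (N := (2 * p ^ s - 1) / 3) h2 h5 hso (by omega) (by omega)
  simp only [← div_pow, ← pochRatio_eq_div_factorial, ← pochRatio_eq_div]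
  exact ratModEq_of_padicDvd main.1 main.2
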